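/- Let $(W,S)$ be a Coxeter group with $S$ finite; for $J\subseteq S$ let $W_J=\langle J\rangle$. Graphs are taken in the sense of Serre: oriented edges $e$ with origin $o(e)$, terminus $t(e)$ and a fixed-point-free inversion $e\mapsto\bar e$ with $\bar{\bar e}=e$ and $o(\bar e)=t(e)$; a tree is a non-empty connected graph without circuits. Let $\Delta=(\mathcal C,\delta)$ be a building of type $(W,S)$ with (non-empty) set of chambers $\mathcal C$ and Weyl distance $\delta\colon\mathcal C\times\mathcal C\to W$, and for $J\subseteq S$, $c\in\mathcal C$ put $\mathrm{Res}_J(c)=\{d\in\mathcal C\mid \delta(c,d)\in W_J\}$. Let $(\mathcal G,\Lambda)$ be a graph of special subgroups of $(W,S)$, i.e. $\Lambda$ is a non-empty connected graph with vertex set $\mathscr V(\Lambda)$ and edge set $\mathscr E(\Lambda)$, each $\lambda\in\mathscr V(\Lambda)\sqcup\mathscr E(\Lambda)$ is assigned a subset $S_\lambda\subseteq S$ and the group $\mathcal G_\lambda=W_{S_\lambda}$, with $S_{\bar e}=S_e\subseteq S_{t(e)}$ for every edge $e$, and the monomorphisms $\mathcal G_e\hookrightarrow\mathcal G_{t(e)}$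 are the inclusions. Fix a vertex $x_0$ of $\Lambda$. The fundamental group $\pi_1(\mathcal G,\Lambda,x_0)$ consists of the elements $r_0e_1r_1\cdots e_nr_n$, where $n\ge 0$, $(e_1,\dots,e_n)$ is a closed path at $x_0$, $r_0\in\mathcal G_{x_0}$ and $r_i\in \mathcal G_{t(e_i)}$ for $1\le i\le n$, of the group generated by all vertex groups and all edges of $\Lambda$ subject to the relations $\bar e=e^{-1}$ and $e\,a\,e^{-1}=a$ for $e\in\mathscr E(\Lambda)$ and $a\in\mathcal G_e$ (with the left-hand $a$ taken in $\mathcal G_{t(e)}$ and the right-hand one in $\mathcal G_{o(e)}$). The pair $(\mathcal G,\Lambda)$ is a visual graph of groups decomposition of $(W,S)$ if the homomorphism $\tau\colon\pi_1(\mathcal G,\Lambda,x_0)\to W$, $r_0e_1r_1\cdots e_nr_n\mapsto r_0r_1\cdots r_n$, induced by the inclusions $W_{S_\lambda}\hookrightarrow W$, is an isomorphism. Let $\Gamma^\Delta_{(\mathcal G,\Lambda)}(\mathcal C)$ be the graph with vertex set $\bigsqcup_{v\in\mathscr V(\Lambda)}\{\mathrm{Res}_{S_v}(c)\mid c\in\mathcal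 C\}$ and edge set $\bigsqcup_{e\in\mathscr E(\Lambda)}\{\mathrm{Res}_{S_e}(c)\mid c\in\mathcal C\}$, in which for every $e\in\mathscr E(\Lambda)$ and $c\in\mathcal C$ the edge $\mathrm{Res}_{S_e}(c)$ in the copy indexed by $e$ has origin $\mathrm{Res}_{S_{o(e)}}(c)$, terminus $\mathrm{Res}_{S_{t(e)}}(c)$ and inverse $\mathrm{Res}_{S_{\bar e}}(c)$ in the copy indexed by $\bar e$. Then the following are equivalent: (i) $(\mathcal G,\Lambda)$ is a visual graph of groups decomposition of $(W,S)$; (ii) $S=\bigcup_{v\in\mathscr V(\Lambda)}S_v$ and $\Gamma^\Delta_{(\mathcal G,\Lambda)}(\mathcal C)$ is a tree. -/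

import Mathlib

universe u₁ u₂ u₃ u₄ u₅

/-! ### Graphs in the sense of Serre -/

/-- A graph in the sense of Serre: oriented edges with a fixed-point-free involution
reversing the orientation. Loops and multiple edges are allowed. -/
structure SerreGraph (V : Type u₁) (E : Type u₂) where
  origin : E → V
  terminus : E → V
  inv : E → E
  inv_inv : ∀ e, inv (inv e) = e
  inv_ne : ∀ e, inv e ≠ e
  origin_inv : ∀ e, origin (inv e) = terminus e

namespace SerreGraph

variable {V : Type u₁} {E : Type u₂} (G : SerreGraph V E)

theorem terminus_inv (e : E) : G.terminus (G.inv e) = G.origin e := by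
  rw [← G.origin_inv, G.inv_inv]

/-- The list of edges `p` is a path from `u` to `v`. -/
def IsPath : V → List E → V → Prop
  | u, [], v => u = v
  | u, e :: p, v => G.origin e = u ∧ IsPath (G.terminus e) p v

/-- A graph is connected if it is non-empty and any two vertices are joined by a path. -/
def Connected : Prop :=
  Nonempty V ∧ ∀ u v, ∃ p, G.IsPath u p v

/-- A circuit: a closed path `(e₁, …, eₙ)` with `n ≥ 1` and without backtracking whose vertices
`t(e₁), …, t(eₙ)` are pairwise distinct. (Loops are the circuits of length one.) -/
def IsCircuit (p : List E) : Prop :=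
  p ≠ [] ∧ (∃ u, G.IsPath u p u) ∧ p.IsChain (fun e f => f ≠ G.inv e) ∧
    (p.map G.terminus).Nodup

/-- A tree is a connected (non-empty) graph without circuits. -/
def IsTree : Prop :=
  G.Connected ∧ ∀ p, ¬ G.IsCircuit p

end SerreGraph

/-! ### Special subgroups and buildings -/

section Buildings

variable {B : Type u₁} {W : Type u₂} [Group W] {M : CoxeterMatrix B}

/-- The special subgroup `W_J` generated by the simple reflections with index in `J`. -/
def specialSubgroup (cs : CoxeterSystem M W) (J : Set B) : Subgroup W :=
  Subgroup.closure (cs.simple '' J)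

theorem specialSubgroup_mono (cs : CoxeterSystem M W) {J K : Set B} (h : J ⊆ K) :
    specialSubgroup cs J ≤ specialSubgroup cs K :=
  Subgroup.closure_mono (Set.image_mono h)

/-- A building of type `(W, S)` with set of chambers `C`, given by its Weyl distance `δ`.
For a simple reflection `s`, the `s`-adjacency relation is `δ c d ∈ {1, s}`. -/
structure Building (cs : CoxeterSystem M W) (C : Type u₃) where
  δ : C → C → W
  nonempty : Nonempty C
  δ_eq_one_iff : ∀ c d, δ c d = 1 ↔ c = d
  δ_of_adj : ∀ (i : B) (c' c d : C), δ c' c = cs.simple i →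
    δ c' d = cs.simple i * δ c d ∨ δ c' d = δ c d
  δ_of_adj_of_length : ∀ (i : B) (c' c d : C), δ c' c = cs.simple i →
    cs.length (cs.simple i * δ c d) = cs.length (δ c d) + 1 →
    δ c' d = cs.simple i * δ c d
  exists_adj : ∀ (i : B) (c d : C),
    ∃ c', δ c' c = cs.simple i ∧ δ c' d = cs.simple i * δ c d

namespace Building

variable {cs : CoxeterSystem M W} {C : Type u₃} (Δ : Building cs C)

/-- The residue `Res_J(c)`. -/
def Res (J : Set B) (c : C) : Set C :=
  {d | Δ.δ c d ∈ specialSubgroup cs J}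

theorem mem_Res_self (J : Set B) (c : C) : c ∈ Δ.Res J c := by
  have h : Δ.δ c c = 1 := (Δ.δ_eq_one_iff c c).2 rfl
  simp [Res, h, one_mem]

theorem Res_eq_of_δ_mem {J : Set B} {c d : C} (h : Δ.δ c d ∈ specialSubgroup cs J) :
    Δ.Res J c = Δ.Res J d := by
  have step : ∀ (i : B), i ∈ J → ∀ w : W, (∀ c, Δ.δ c d = w → Δ.Res J c = Δ.Res J d) →
      ∀ c, Δ.δ c d = cs.simple i * w → Δ.Res J c = Δ.Res J d := by
    intro i hi w ih c hc
    obtain ⟨c', h1, h2⟩ := Δ.exists_adj i c d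
    have hs : cs.simple i ∈ specialSubgroup cs J :=
      Subgroup.subset_closure (Set.mem_image_of_mem _ hi)
    rw [← ih c' (by rw [h2, hc, cs.simple_mul_simple_cancel_left])]
    ext x
    change Δ.δ c x ∈ specialSubgroup cs J ↔ Δ.δ c' x ∈ specialSubgroup cs J
    rcases Δ.δ_of_adj i c' c x h1 with h | h
    · rw [h]
      exact ((specialSubgroup cs J).mul_mem_cancel_left hs).symm
    · rw [h]
  have key : ∀ w ∈ specialSubgroup cs J, ∀ c, Δ.δ c d = w → Δ.Res J c = Δ.Res J d := by
    intro w hw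
    induction hw using Subgroup.closure_induction_left with
    | one =>
      intro c hc
      rw [(Δ.δ_eq_one_iff c d).1 hc]
    | mul_left x hx y hy ih =>
      obtain ⟨i, hi, rfl⟩ := hx
      exact step i hi y ih
    | inv_mul_cancel x hx y hy ih =>
      obtain ⟨i, hi, rfl⟩ := hx
      rw [cs.inv_simple]
      exact step i hi y ih
  exact key _ h c rfl

theorem Res_eq_iff {J : Set B} {c d : C} :
    Δ.Res J c = Δ.Res J d ↔ Δ.δ c d ∈ specialSubgroup cs J := by
  refine ⟨fun h => ?_, Δ.Res_eq_of_δ_mem⟩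
  have := Δ.mem_Res_self J d
  rwa [← h] at this

/-- The set `R_J(N) = {Res_J(c) | c ∈ N}`. -/
def residues (J : Set B) (N : Set C) : Set (Set C) :=
  Δ.Res J '' N

/-- The union of all `K`-residues that meet `R`; for `J ⊆ K` it sends `Res_J(c)` to `Res_K(c)`,
see `enlarge_Res`. -/
def enlarge (K : Set B) (R : Set C) : Set C :=
  ⋃ c ∈ R, Δ.Res K c

theorem enlarge_Res {J K : Set B} (h : J ⊆ K) (c : C) :
    Δ.enlarge K (Δ.Res J c) = Δ.Res K c := by
  apply Set.Subset.antisymm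
  · refine Set.iUnion₂_subset fun d hd => ?_
    rw [Δ.Res_eq_of_δ_mem (specialSubgroup_mono cs h hd)]
  · exact Set.subset_iUnion₂_of_subset c (Δ.mem_Res_self J c) subset_rfl

theorem enlarge_mem_residues {J K : Set B} (h : J ⊆ K) {N : Set C} {R : Set C}
    (hR : R ∈ Δ.residues J N) : Δ.enlarge K R ∈ Δ.residues K N := by
  obtain ⟨c, hc, rfl⟩ := hR
  exact ⟨c, hc, (Δ.enlarge_Res h c).symm⟩

end Building

end Buildings

/-! ### Graphs of special subgroups -/

/-- A graph of special subgroups based on the connected graph `Λ`: to every vertex and every edge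
a subset of `S` is assigned, so that `S_ē = S_e` and `S_e ⊆ S_{t(e)}`. The group at `x` is
`W_{S_x}`, and the monomorphisms of the edge groups into the vertex groups are the inclusions. -/
structure SpecialGraph (B : Type u₁) {V : Type u₂} {E : Type u₃} (Λ : SerreGraph V E) where
  connected : Λ.Connected
  vset : V → Set B
  eset : E → Set B
  eset_inv : ∀ e, eset (Λ.inv e) = eset e
  eset_subset : ∀ e, eset e ⊆ vset (Λ.terminus e)

namespace SpecialGraph

variable {B : Type u₁} {W : Type u₂} [Group W] {M : CoxeterMatrix B}
  {V : Type u₃} {E : Type u₄} {Λ : SerreGraph V E}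

theorem eset_subset_origin (𝒢 : SpecialGraph B Λ) (e : E) :
    𝒢.eset e ⊆ 𝒢.vset (Λ.origin e) := by
  have h := 𝒢.eset_subset (Λ.inv e)
  rwa [𝒢.eset_inv, Λ.terminus_inv] at h

/-! #### The fundamental group -/

/-- The free product of all vertex groups and of the free group on the edges of `Λ`. -/
abbrev FreeProd (𝒢 : SpecialGraph B Λ) (cs : CoxeterSystem M W) : Type _ :=
  Monoid.Coprod (Monoid.CoprodI fun v : V => specialSubgroup cs (𝒢.vset v)) (FreeGroup E)

/-- The element `a` of the vertex group at `v`, inside the free product. -/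
def preVertex (𝒢 : SpecialGraph B Λ) (cs : CoxeterSystem M W) (v : V)
    (a : specialSubgroup cs (𝒢.vset v)) : 𝒢.FreeProd cs :=
  Monoid.Coprod.inl
    (Monoid.CoprodI.of (M := fun v : V => specialSubgroup cs (𝒢.vset v)) (i := v) a)

/-- The generator attached to the edge `e`, inside the free product. -/
def preEdge (𝒢 : SpecialGraph B Λ) (cs : CoxeterSystem M W) (e : E) : 𝒢.FreeProd cs :=
  Monoid.Coprod.inr (FreeGroup.of e)

/-- The relators expressing `ē = e⁻¹`, and `e a e⁻¹ = a` for `a` in the edge group of `e`, where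
the first `a` is taken in the vertex group at `t(e)` and the second in that at `o(e)`. -/
def relators (𝒢 : SpecialGraph B Λ) (cs : CoxeterSystem M W) : Set (𝒢.FreeProd cs) :=
  {x | ∃ e, x = 𝒢.preEdge cs (Λ.inv e) * 𝒢.preEdge cs e} ∪
  {x | ∃ (e : E) (a : W) (ha : a ∈ specialSubgroup cs (𝒢.eset e)),
    x = 𝒢.preEdge cs e *
      𝒢.preVertex cs (Λ.terminus e) ⟨a, specialSubgroup_mono cs (𝒢.eset_subset e) ha⟩ *
      (𝒢.preEdge cs e)⁻¹ *
      (𝒢.preVertex cs (Λ.origin e)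
        ⟨a, specialSubgroup_mono cs (𝒢.eset_subset_origin e) ha⟩)⁻¹}

/-- The group `F(𝒢, Λ)` generated by the vertex groups and the edges, subject to `relators`. -/
abbrev PathGroup (𝒢 : SpecialGraph B Λ) (cs : CoxeterSystem M W) : Type _ :=
  𝒢.FreeProd cs ⧸ Subgroup.normalClosure (𝒢.relators cs)

/-- The element of `F(𝒢, Λ)` given by the element `a` of the vertex group at `v`. -/
def vertexElt (𝒢 : SpecialGraph B Λ) (cs : CoxeterSystem M W) (v : V)
    (a : specialSubgroup cs (𝒢.vset v)) : 𝒢.PathGroup cs :=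
  QuotientGroup.mk (𝒢.preVertex cs v a)

/-- The element of `F(𝒢, Λ)` given by the edge `e`. -/
def edgeElt (𝒢 : SpecialGraph B Λ) (cs : CoxeterSystem M W) (e : E) : 𝒢.PathGroup cs :=
  QuotientGroup.mk (𝒢.preEdge cs e)

theorem vertexElt_one (𝒢 : SpecialGraph B Λ) (cs : CoxeterSystem M W) (v : V) :
    𝒢.vertexElt cs v 1 = 1 := by
  simp [vertexElt, preVertex]

theorem vertexElt_mul (𝒢 : SpecialGraph B Λ) (cs : CoxeterSystem M W) (v : V)
    (a b : specialSubgroup cs (𝒢.vset v)) :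
    𝒢.vertexElt cs v (a * b) = 𝒢.vertexElt cs v a * 𝒢.vertexElt cs v b := by
  simp [vertexElt, preVertex]

theorem vertexElt_inv (𝒢 : SpecialGraph B Λ) (cs : CoxeterSystem M W) (v : V)
    (a : specialSubgroup cs (𝒢.vset v)) :
    𝒢.vertexElt cs v a⁻¹ = (𝒢.vertexElt cs v a)⁻¹ := by
  rw [eq_inv_iff_mul_eq_one, ← vertexElt_mul, inv_mul_cancel, vertexElt_one]

theorem edgeElt_inv (𝒢 : SpecialGraph B Λ) (cs : CoxeterSystem M W) (e : E) :
    𝒢.edgeElt cs (Λ.inv e) = (𝒢.edgeElt cs e)⁻¹ := by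
  rw [eq_inv_iff_mul_eq_one]
  exact (QuotientGroup.eq_one_iff _).2 (Subgroup.subset_normalClosure (Or.inl ⟨e, rfl⟩))

/-- `IsPathWord u v x` says that `x = r₀ e₁ r₁ e₂ ⋯ eₙ rₙ` in `F(𝒢, Λ)` for some path
`(e₁, …, eₙ)` from `u` to `v`, `n ≥ 0`, where `rᵢ` lies in the group of its `i`-th vertex. -/
inductive IsPathWord (𝒢 : SpecialGraph B Λ) (cs : CoxeterSystem M W) :
    V → V → 𝒢.PathGroup cs → Prop
  | nil (v : V) (a : specialSubgroup cs (𝒢.vset v)) : IsPathWord 𝒢 cs v v (𝒢.vertexElt cs v a)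
  | cons (e : E) (a : specialSubgroup cs (𝒢.vset (Λ.origin e))) (w : V) (x : 𝒢.PathGroup cs)
      (h : IsPathWord 𝒢 cs (Λ.terminus e) w x) :
      IsPathWord 𝒢 cs (Λ.origin e) w (𝒢.vertexElt cs (Λ.origin e) a * 𝒢.edgeElt cs e * x)

theorem IsPathWord.vertexElt_mul {𝒢 : SpecialGraph B Λ} {cs : CoxeterSystem M W} {u v : V}
    {x : 𝒢.PathGroup cs} (h : 𝒢.IsPathWord cs u v x) (a : specialSubgroup cs (𝒢.vset u)) :
    𝒢.IsPathWord cs u v (𝒢.vertexElt cs u a * x) := by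
  cases h with
  | nil b =>
    rw [← SpecialGraph.vertexElt_mul]
    exact .nil _ _
  | cons e b _ y hy =>
    rw [← mul_assoc, ← mul_assoc, ← SpecialGraph.vertexElt_mul]
    exact .cons e _ _ _ hy

theorem IsPathWord.mul {𝒢 : SpecialGraph B Λ} {cs : CoxeterSystem M W} {u v w : V}
    {x y : 𝒢.PathGroup cs} (hx : 𝒢.IsPathWord cs u v x) (hy : 𝒢.IsPathWord cs v w y) :
    𝒢.IsPathWord cs u w (x * y) := by
  induction hx with
  | nil v a => exact hy.vertexElt_mul a
  | cons e a v x h ih =>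
    rw [mul_assoc]
    exact .cons e a _ _ (ih hy)

theorem IsPathWord.edge_inv (𝒢 : SpecialGraph B Λ) (cs : CoxeterSystem M W) (e : E) :
    𝒢.IsPathWord cs (Λ.terminus e) (Λ.origin e) (𝒢.edgeElt cs e)⁻¹ := by
  have h := IsPathWord.cons (𝒢 := 𝒢) (cs := cs) (Λ.inv e) 1 _ _ (.nil _ 1)
  rw [vertexElt_one, vertexElt_one, one_mul, mul_one, edgeElt_inv] at h
  rwa [Λ.origin_inv, Λ.terminus_inv] at h

theorem IsPathWord.inv {𝒢 : SpecialGraph B Λ} {cs : CoxeterSystem M W} {u v : V}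
    {x : 𝒢.PathGroup cs} (hx : 𝒢.IsPathWord cs u v x) : 𝒢.IsPathWord cs v u x⁻¹ := by
  induction hx with
  | nil v a =>
    rw [← vertexElt_inv]
    exact .nil _ _
  | cons e a v x h ih =>
    rw [mul_inv_rev, mul_inv_rev, ← vertexElt_inv]
    exact ih.mul ((IsPathWord.edge_inv 𝒢 cs e).mul (.nil _ _))

/-- The fundamental group `π₁(𝒢, Λ, x₀)`: the subgroup of `F(𝒢, Λ)` of all elements represented
by words along closed paths at `x₀`. -/
def fundamentalGroup (𝒢 : SpecialGraph B Λ) (cs : CoxeterSystem M W) (x₀ : V) :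
    Subgroup (𝒢.PathGroup cs) where
  carrier := {x | 𝒢.IsPathWord cs x₀ x₀ x}
  mul_mem' := fun hx hy => IsPathWord.mul hx hy
  one_mem' := by
    have h := IsPathWord.nil (𝒢 := 𝒢) (cs := cs) x₀ 1
    rwa [vertexElt_one] at h
  inv_mem' := fun hx => IsPathWord.inv hx

/-- The homomorphism from the free product to `W` that is the inclusion on every vertex group and
trivial on the edges. -/
def preTau (𝒢 : SpecialGraph B Λ) (cs : CoxeterSystem M W) : 𝒢.FreeProd cs →* W :=
  Monoid.Coprod.lift
    (Monoid.CoprodI.lift fun v : V => (specialSubgroup cs (𝒢.vset v)).subtype) 1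

theorem preTau_preVertex (𝒢 : SpecialGraph B Λ) (cs : CoxeterSystem M W) (v : V)
    (a : specialSubgroup cs (𝒢.vset v)) : 𝒢.preTau cs (𝒢.preVertex cs v a) = a := by
  simp [preTau, preVertex]

theorem preTau_preEdge (𝒢 : SpecialGraph B Λ) (cs : CoxeterSystem M W) (e : E) :
    𝒢.preTau cs (𝒢.preEdge cs e) = 1 := by
  simp [preTau, preEdge]

theorem normalClosure_relators_le_ker (𝒢 : SpecialGraph B Λ) (cs : CoxeterSystem M W) :
    Subgroup.normalClosure (𝒢.relators cs) ≤ (𝒢.preTau cs).ker := by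
  refine Subgroup.normalClosure_le_normal ?_
  rintro x (⟨e, rfl⟩ | ⟨e, a, ha, rfl⟩)
  · simp [MonoidHom.mem_ker, preTau_preEdge]
  · simp [MonoidHom.mem_ker, preTau_preEdge, preTau_preVertex]

/-- The homomorphism `F(𝒢, Λ) → W` induced by the inclusions of the vertex groups. -/
def pathTau (𝒢 : SpecialGraph B Λ) (cs : CoxeterSystem M W) : 𝒢.PathGroup cs →* W :=
  QuotientGroup.lift _ (𝒢.preTau cs) (𝒢.normalClosure_relators_le_ker cs)

/-- The homomorphism `τ : π₁(𝒢, Λ, x₀) → W`, sending `r₀ e₁ r₁ ⋯ eₙ rₙ` to `r₀ r₁ ⋯ rₙ`. -/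
def tau (𝒢 : SpecialGraph B Λ) (cs : CoxeterSystem M W) (x₀ : V) :
    𝒢.fundamentalGroup cs x₀ →* W :=
  (𝒢.pathTau cs).comp (𝒢.fundamentalGroup cs x₀).subtype

/-- `(𝒢, Λ)` is a visual graph of groups decomposition of `(W, S)`: the homomorphism
`τ : π₁(𝒢, Λ, x₀) → W` is an isomorphism. -/
def IsVisualDecomposition (𝒢 : SpecialGraph B Λ) (cs : CoxeterSystem M W) (x₀ : V) : Prop :=
  Function.Bijective (𝒢.tau cs x₀)

/-! #### The residue graph -/

variable {cs : CoxeterSystem M W} {C : Type u₅}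

/-- The vertices of the residue graph: the disjoint union over `v` of the sets `R_{S_v}(N)`. -/
abbrev ResidueVertex (𝒢 : SpecialGraph B Λ) (Δ : Building cs C) (N : Set C) : Type _ :=
  Σ v : V, Δ.residues (𝒢.vset v) N

/-- The edges of the residue graph: the disjoint union over `e` of the sets `R_{S_e}(N)`. -/
abbrev ResidueEdge (𝒢 : SpecialGraph B Λ) (Δ : Building cs C) (N : Set C) : Type _ :=
  Σ e : E, Δ.residues (𝒢.eset e) N

theorem residue_sigma_ext {ι : Type*} {C : Type*} {P : ι → Set (Set C)} {i j : ι} {a b : Set C}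
    {ha : a ∈ P i} {hb : b ∈ P j} (h₁ : i = j) (h₂ : a = b) :
    (⟨i, a, ha⟩ : Σ i, P i) = ⟨j, b, hb⟩ := by
  cases h₁
  cases h₂
  rfl

/-- The residue graph `Γ(N)` of a set `N` of chambers, where `o`, `t` and the inversion send the
edge `Res_{S_e}(c)` to `Res_{S_{o(e)}}(c)`, `Res_{S_{t(e)}}(c)` and the edge `Res_{S_ē}(c)`. -/
def residueGraph (𝒢 : SpecialGraph B Λ) (Δ : Building cs C) (N : Set C) :
    SerreGraph (𝒢.ResidueVertex Δ N) (𝒢.ResidueEdge Δ N) where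
  origin x := ⟨Λ.origin x.1, Δ.enlarge (𝒢.vset (Λ.origin x.1)) x.2,
    Δ.enlarge_mem_residues (𝒢.eset_subset_origin x.1) x.2.2⟩
  terminus x := ⟨Λ.terminus x.1, Δ.enlarge (𝒢.vset (Λ.terminus x.1)) x.2,
    Δ.enlarge_mem_residues (𝒢.eset_subset x.1) x.2.2⟩
  inv x := ⟨Λ.inv x.1, x.2, by rw [𝒢.eset_inv]; exact x.2.2⟩
  inv_inv x := residue_sigma_ext (P := fun e => Δ.residues (𝒢.eset e) N) (Λ.inv_inv x.1) rfl
  inv_ne x h := Λ.inv_ne x.1 (congrArg Sigma.fst h)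
  origin_inv x := residue_sigma_ext (P := fun v => Δ.residues (𝒢.vset v) N)
    (Λ.origin_inv x.1)
    (congrArg (fun v => Δ.enlarge (𝒢.vset v) x.2) (Λ.origin_inv x.1))

end SpecialGraph

/-! A word r₀e₁r₁⋯eₙrₙ along a path of `Λ` describes a path in the residue graph, and `pathTau`
records the displacement in W. Hence kernel elements of τ correspond to closed paths, while
surjectivity of τ amounts to S = ⋃ S_v: a simple reflection lies in W_J only if its index lies in J,
as the geometric representation shows. When S = ⋃ S_v, galleries make the residue graph connected,
so the issue is circuits versus injectivity.

From tree to isomorphism: an element of ker τ lifts to a path starting at c₀ whose final chamber has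
retraction 1, hence is c₀. This closed path shrinks to the trivial one by deleting backtracks, and
each deletion is an instance of e a e⁻¹ = a (`wordElt_eq_one`).

From isomorphism to tree, the thin building comes first (`thin_not_isCircuit`). A cochain on the
edges of its residue graph defines a homomorphism from `PathGroup` to Fun(W, A) ⋊ W. Bijectivity of
τ makes the sum of the cochain along a path depend only on the endpoints, so every cochain is a
coboundary. For the signed indicator of an edge this excludes circuits through that edge.

A general building is retracted onto W from a chamber c₀ in a residue on the circuit; the point is
that no backtrack is created (`reduced_map_retractEdge`). If two successive edges were folded
together, the tree property of the thin graph would put the shortest element m of the coset of their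
common vertex into their common image. Both edges would then contain a chamber over m, and the
residue has only one (`Building.eq_of_retract_eq`, resting on the exchange condition), so the edges
were already mutually inverse. -/

namespace CoxeterSystem

/-! ### The geometric representation and simple reflections in special subgroups. -/

section Geometric

variable {B : Type*} {W : Type*} [Group W] {M : CoxeterMatrix B}

/-- The functional `v ↦ 2 ⟨αᵢ, v⟩` of the geometric representation, where
`⟨αᵢ, αⱼ⟩ = -cos (π / M i j)`. -/
noncomputable def simpleCoroot (M : CoxeterMatrix B) (i : B) : (B →₀ ℝ) →ₗ[ℝ] ℝ :=
  Finsupp.linearCombination ℝ fun j => -2 * Real.cos (Real.pi / M i j)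

/-- The reflection `v ↦ v - 2 ⟨αᵢ, v⟩ αᵢ` of the geometric representation. -/
noncomputable def geomReflection (M : CoxeterMatrix B) (i : B) : Module.End ℝ (B →₀ ℝ) :=
  LinearMap.id - (simpleCoroot M i).smulRight (Finsupp.single i 1)

theorem geomReflection_apply (M : CoxeterMatrix B) (i : B) (v : B →₀ ℝ) :
    geomReflection M i v = v - simpleCoroot M i v • Finsupp.single i 1 := by
  simp [geomReflection]

theorem simpleCoroot_single (M : CoxeterMatrix B) (i j : B) :
    simpleCoroot M i (Finsupp.single j 1) = -2 * Real.cos (Real.pi / M i j) := by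
  simp [simpleCoroot]

theorem simpleCoroot_single_self (M : CoxeterMatrix B) (i : B) :
    simpleCoroot M i (Finsupp.single i 1) = 2 := by
  simp [simpleCoroot_single]

/-- For i ≠ j and finite m = `M i j`, the product of the two reflections acts on the plane of αᵢ and
αⱼ as a rotation by 2π/m and fixes the common kernel of the two coroots; the plane and this kernel
span the space. -/
theorem isLiftable_geomReflection (M : CoxeterMatrix B) :
    M.IsLiftable (geomReflection M) := by
  intro i j
  rcases eq_or_ne i j with rfl | hij
  · rw [M.diagonal, pow_one]
    refine LinearMap.ext fun v => ?_
    simp only [Module.End.mul_apply, geomReflection_apply, map_sub, map_smul,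
      simpleCoroot_single_self, Module.End.one_apply]
    module
  rcases eq_or_ne (M i j) 0 with h0 | h0
  · rw [h0, pow_zero]
  have hm : 2 ≤ M i j := by
    have := M.off_diagonal i j hij
    omega
  have hmR : (2 : ℝ) ≤ M i j := by exact_mod_cast hm
  set θ : ℝ := Real.pi / M i j with hθ
  have hθpos : 0 < θ := by positivity
  have hθlt : θ < Real.pi := by
    rw [hθ, div_lt_iff₀ (by linarith)]
    nlinarith [Real.pi_pos]
  have hsin : Real.sin θ ≠ 0 := (Real.sin_pos_of_pos_of_lt_pi hθpos hθlt).ne'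
  have hmθ : (M i j : ℝ) * θ = Real.pi := by
    rw [hθ]; field_simp
  set x : B →₀ ℝ := Finsupp.single i 1 with hx
  set y : B →₀ ℝ := Finsupp.single j 1 with hy
  have hfx : simpleCoroot M i x = 2 := simpleCoroot_single_self M i
  have hgy : simpleCoroot M j y = 2 := simpleCoroot_single_self M j
  have hfy : simpleCoroot M i y = -2 * Real.cos θ := simpleCoroot_single M i j
  have hgx : simpleCoroot M j x = -2 * Real.cos θ := by
    rw [hx, simpleCoroot_single, M.symmetric]
  have happ (v : B →₀ ℝ) : (geomReflection M i * geomReflection M j) v =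
      v - simpleCoroot M j v • y - simpleCoroot M i (v - simpleCoroot M j v • y) • x := by
    simp only [Module.End.mul_apply, geomReflection_apply, ← hx, ← hy]
  have hX : (geomReflection M i * geomReflection M j) x =
      (4 * Real.cos θ ^ 2 - 1) • x + (2 * Real.cos θ) • y := by
    rw [happ, map_sub, map_smul, hfx, hgx, hfy]
    simp only [smul_eq_mul]
    module
  have hY : (geomReflection M i * geomReflection M j) y =
      -y - (2 * Real.cos θ) • x := by
    rw [happ, map_sub, map_smul, hgy, hfy]
    simp only [smul_eq_mul]
    module
  have hstep (a : ℝ) : Real.sin (a + θ + θ) = 2 * Real.cos θ * Real.sin (a + θ) - Real.sin a := by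
    rw [Real.sin_add (a + θ), Real.cos_add, Real.sin_add]
    linear_combination -Real.sin a * (Real.sin_sq_add_cos_sq θ)
  -- Powers of the rotation in the basis x, y; the factor sin θ clears denominators.
  have hpow (k : ℕ) :
      Real.sin θ • ((geomReflection M i * geomReflection M j) ^ k) x =
          Real.sin (2 * k * θ + θ) • x + Real.sin (2 * k * θ) • y ∧
        Real.sin θ • ((geomReflection M i * geomReflection M j) ^ k) y =
          -Real.sin (2 * k * θ) • x - Real.sin (2 * k * θ - θ) • y := by
    induction k with
    | zero => simp
    | succ k ih =>
      have h1 := hstep (2 * k * θ - θ)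
      have h2 := hstep (2 * k * θ)
      have h3 := hstep (2 * k * θ + θ)
      rw [sub_add_cancel] at h1
      have e1 : 2 * ((k + 1 : ℕ) : ℝ) * θ = 2 * k * θ + θ + θ := by push_cast; ring
      have e2 : 2 * k * θ + θ + θ - θ = 2 * k * θ + θ := by ring
      have hmul (r : ℝ) (v : B →₀ ℝ) :
          r • ((geomReflection M i * geomReflection M j) ^ (k + 1)) v =
            (geomReflection M i * geomReflection M j)
              (r • ((geomReflection M i * geomReflection M j) ^ k) v) := by
        rw [pow_succ', map_smul]
        rfl
      rw [hmul, hmul, ih.1, ih.2, map_add, map_sub, map_smul, map_smul, map_smul, map_smul, hX, hY, e1, e2]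
      constructor
      · match_scalars
        · rw [h3, h2]; ring
        · rw [h2]; ring
      · match_scalars
        · rw [h2, h1]; ring
        · rw [h1]; ring
  have hfix (u : B →₀ ℝ) (hf : simpleCoroot M i u = 0) (hg : simpleCoroot M j u = 0) (k : ℕ) :
      ((geomReflection M i * geomReflection M j) ^ k) u = u := by
    induction k with
    | zero => simp
    | succ k ih => rw [pow_succ, Module.End.mul_apply, happ, hg]; simpa [hf] using ih
  obtain ⟨hpx, hpy⟩ := hpow (M i j)
  have e3 : 2 * (M i j : ℝ) * θ = 2 * Real.pi := by rw [mul_assoc, hmθ]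
  rw [e3, add_comm (2 * Real.pi), Real.sin_add_two_pi, Real.sin_two_pi, zero_smul, add_zero] at hpx
  rw [e3, Real.sin_two_pi_sub, Real.sin_two_pi] at hpy
  have hpx' := smul_right_injective _ hsin hpx
  have hpy' : ((geomReflection M i * geomReflection M j) ^ M i j) y = y :=
    smul_right_injective _ hsin (by simpa using hpy)
  refine LinearMap.ext fun v => ?_
  set a := simpleCoroot M i v
  set b := simpleCoroot M j v
  -- p and q solve the 2 × 2 system saying that both coroots vanish on v - p x - q y; it is solvable
  -- because sin θ ≠ 0.
  set p := (a + Real.cos θ * b) / (2 * Real.sin θ ^ 2) with hp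
  set q := (b + Real.cos θ * a) / (2 * Real.sin θ ^ 2) with hq
  have hv : v = (v - p • x - q • y) + p • x + q • y := by module
  have hs2 := Real.sin_sq_add_cos_sq θ
  have h1 : simpleCoroot M i (v - p • x - q • y) = 0 := by
    rw [map_sub, map_sub, map_smul, map_smul, hfx, hfy, smul_eq_mul, smul_eq_mul, hp, hq]
    change a - _ - _ = 0
    field_simp
    linear_combination a * hs2
  have h2 : simpleCoroot M j (v - p • x - q • y) = 0 := by
    rw [map_sub, map_sub, map_smul, map_smul, hgx, hgy, smul_eq_mul, smul_eq_mul, hp, hq]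
    change b - _ - _ = 0
    field_simp
    linear_combination b * hs2
  rw [hv, map_add, map_add, map_smul, map_smul, hpx', hpy', hfix _ h1 h2, Module.End.one_apply]

/-- The geometric representation of a Coxeter group. -/
noncomputable def geomRep (cs : CoxeterSystem M W) : W →* Module.End ℝ (B →₀ ℝ) :=
  cs.lift ⟨geomReflection M, isLiftable_geomReflection M⟩

theorem geomRep_simple (cs : CoxeterSystem M W) (i : B) :
    cs.geomRep (cs.simple i) = geomReflection M i :=
  cs.lift_apply_simple (isLiftable_geomReflection M) i

theorem geomRep_apply_of_mem_specialSubgroup (cs : CoxeterSystem M W) {J : Set B} {i : B}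
    (hi : i ∉ J) {w : W} (hw : w ∈ specialSubgroup cs J) (v : B →₀ ℝ) :
    cs.geomRep w v i = v i := by
  have step : ∀ j ∈ J, ∀ v, geomReflection M j v i = v i := by
    intro j hj v
    have : j ≠ i := fun h => hi (h ▸ hj)
    simp [geomReflection_apply, this]
  induction hw using Subgroup.closure_induction_left with
  | one => simp
  | mul_left x hx y hy ih =>
    obtain ⟨j, hj, rfl⟩ := hx
    rw [map_mul, Module.End.mul_apply, geomRep_simple, step j hj, ih]
  | inv_mul_cancel x hx y hy ih =>
    obtain ⟨j, hj, rfl⟩ := hx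
    rw [cs.inv_simple, map_mul, Module.End.mul_apply, geomRep_simple, step j hj, ih]

/-- If i ∉ J, then W_J preserves the i-th coordinate, whereas sᵢ sends αᵢ to -αᵢ. -/
theorem mem_of_simple_mem_specialSubgroup (cs : CoxeterSystem M W) {J : Set B} {i : B}
    (h : cs.simple i ∈ specialSubgroup cs J) : i ∈ J := by
  by_contra hi
  have := cs.geomRep_apply_of_mem_specialSubgroup hi h (Finsupp.single i 1)
  rw [geomRep_simple, geomReflection_apply, simpleCoroot_single_self] at this
  norm_num at this

end Geometric

/-! ### The exchange condition and minimal coset representatives. -/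

section Exchange

variable {B : Type*} {W : Type*} [Group W] {M : CoxeterMatrix B} (cs : CoxeterSystem M W)

open Classical in
/-- The permutation `(t, ε) ↦ (sᵢ t sᵢ, ε + [t = sᵢ])`. -/
noncomputable def titsPerm (i : B) : Equiv.Perm (W × ZMod 2) :=
  Function.Involutive.toPerm
    (fun x => (cs.simple i * x.1 * cs.simple i, x.2 + if x.1 = cs.simple i then 1 else 0)) (by
      rintro ⟨t, ε⟩
      have h : cs.simple i * t * cs.simple i = cs.simple i ↔ t = cs.simple i := by
        rw [mul_eq_right, mul_eq_one_iff_eq_inv', cs.inv_simple]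
      ext
      · simp [mul_assoc]
      · simp only [h]
        split_ifs
        · rw [add_assoc, show (1 : ZMod 2) + 1 = 0 from by decide, add_zero]
        · simp)

open Classical in
theorem titsPerm_apply (i : B) (x : W × ZMod 2) :
    cs.titsPerm i x =
      (cs.simple i * x.1 * cs.simple i, x.2 + if x.1 = cs.simple i then 1 else 0) := rfl

-- The second component counts inversions modulo 2. Once the permutations are known to satisfy the
-- Coxeter relations, this parity is an invariant of the group element.
open Classical in
theorem prod_titsPerm_apply (ω : List B) (t : W) (ε : ZMod 2) :
    (ω.map cs.titsPerm).prod (t, ε) =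
      (cs.wordProd ω * t * (cs.wordProd ω)⁻¹, ε + ((cs.rightInvSeq ω).count t : ZMod 2)) := by
  induction ω with
  | nil => simp
  | cons i ω ih =>
    have h : cs.wordProd ω * t * (cs.wordProd ω)⁻¹ = cs.simple i ↔
        (cs.wordProd ω)⁻¹ * cs.simple i * cs.wordProd ω = t := by
      constructor
      · intro h; rw [← h]; group
      · rintro rfl; group
    rw [List.map_cons, List.prod_cons, Equiv.Perm.mul_apply, ih, titsPerm_apply, rightInvSeq,
      List.count_cons, wordProd_cons]
    ext
    · simp [mul_assoc]
    · simp only [h, beq_iff_eq, Nat.cast_add, add_assoc, Nat.cast_ite, Nat.cast_one, Nat.cast_zero]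

theorem prod_titsPerm_alternatingWord (i j : B) (m : ℕ) :
    (((alternatingWord i j (2 * m)).map cs.titsPerm).prod) =
      (cs.titsPerm i * cs.titsPerm j) ^ m := by
  induction m with
  | zero => simp [alternatingWord]
  | succ m ih =>
    rw [show 2 * (m + 1) = 2 * m + 1 + 1 by ring, alternatingWord_succ', alternatingWord_succ',
      pow_succ', ← ih]
    simp [mul_assoc, parity_simps]

theorem even_count_rightInvSeq [DecidableEq W] (i j : B) (t : W) :
    Even ((cs.rightInvSeq (alternatingWord i j (2 * M i j))).count t) := by
  have hrev : ∀ ω : List B,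
      (cs.rightInvSeq ω).count t = (cs.leftInvSeq ω.reverse).count t := by
    intro ω
    rw [leftInvSeq_reverse, List.count_reverse]
  have hword : (alternatingWord i j (2 * M i j)).reverse = alternatingWord j i (2 * M i j) := by
    apply List.ext_getElem
    · simp
    · intro k h1 h2
      simp only [List.length_reverse, length_alternatingWord] at h1 h2
      rw [List.getElem_reverse, getElem_alternatingWord _ _ _ _ (by simp; omega),
        getElem_alternatingWord _ _ _ _ h2]
      simp only [length_alternatingWord]
      grind
  rw [hrev, hword]
  set l := cs.leftInvSeq (alternatingWord j i (2 * M i j)) with hl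
  have hlen : l.length = 2 * M i j := by simp [hl]
  -- Since (sⱼ sᵢ)^m = 1, the inversion sequence of the alternating word of length 2m is periodic
  -- with period m, so each element occurs an even number of times.
  have hsplit : l.drop (M i j) = l.take (M i j) := by
    apply List.ext_getElem
    · simp [hlen]; omega
    · intro k h1 h2
      simp only [List.length_drop, List.length_take, hlen] at h1 h2
      rw [List.getElem_drop, List.getElem_take]
      simp only [hl]
      rw [getElem_leftInvSeq_alternatingWord _ _ _ _ _ (by omega),
        getElem_leftInvSeq_alternatingWord _ _ _ _ _ (by omega),
        prod_alternatingWord_eq_mul_pow, prod_alternatingWord_eq_mul_pow]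
      have e1 : (2 * (M i j + k) + 1) / 2 = M i j + k := by omega
      have e2 : (2 * k + 1) / 2 = k := by omega
      rw [e1, e2, pow_add, simple_mul_simple_pow, one_mul]
      simp [parity_simps]
  rw [← List.take_append_drop (M i j) l, hsplit, List.count_append]
  exact ⟨_, rfl⟩

theorem isLiftable_titsPerm : M.IsLiftable cs.titsPerm := by
  classical
  intro i j
  rw [← prod_titsPerm_alternatingWord]
  ext1 ⟨t, ε⟩
  have h : cs.wordProd (alternatingWord i j (2 * M i j)) = 1 := by
    simp [prod_alternatingWord_eq_mul_pow]
  rw [prod_titsPerm_apply, h, (ZMod.natCast_eq_zero_iff_even).2 (cs.even_count_rightInvSeq i j t)]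
  simp

open Classical in
/-- The parity of the number of occurrences of `t` in the right inversion sequence of a word
depends only on the product of the word. -/
theorem count_rightInvSeq_eq_of_wordProd_eq {ω ω' : List B}
    (h : cs.wordProd ω = cs.wordProd ω') (t : W) :
    ((cs.rightInvSeq ω).count t : ZMod 2) = ((cs.rightInvSeq ω').count t : ZMod 2) := by
  have key : ∀ ω : List B, cs.lift ⟨_, cs.isLiftable_titsPerm⟩ (cs.wordProd ω) =
      (ω.map cs.titsPerm).prod := by
    intro ω
    rw [wordProd, map_list_prod, List.map_map]
    congr 1
    refine List.map_congr_left fun i _ => ?_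
    exact cs.lift_apply_simple cs.isLiftable_titsPerm i
  have h1 := key ω
  rw [h, key ω'] at h1
  have h2 := congrArg (fun f => (f (t, 0)).2) h1
  simp only [prod_titsPerm_apply, zero_add] at h2
  exact h2.symm

/-- The exchange condition. -/
theorem exists_eraseIdx_of_isRightDescent {ω : List B} {i : B}
    (h : cs.IsRightDescent (cs.wordProd ω) i) :
    ∃ j < ω.length, cs.wordProd ω * cs.simple i = cs.wordProd (ω.eraseIdx j) := by
  classical
  -- Appending i to a reduced word for w sᵢ gives another word for w. There sᵢ is an inversion
  -- exactly once, at the last letter, so by parity it is also one for ω.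
  obtain ⟨ω', hred, hω'⟩ := cs.exists_isReduced (cs.wordProd ω * cs.simple i)
  have hprod : cs.wordProd ω = cs.wordProd (ω'.concat i) := by
    rw [wordProd_concat, ← hω', simple_mul_simple_cancel_right]
  have hnot : cs.simple i ∉ cs.rightInvSeq ω' := by
    intro hmem
    have h2 := (cs.isRightInversion_of_mem_rightInvSeq hred hmem).2
    rw [← hω', simple_mul_simple_cancel_right] at h2
    exact lt_asymm h h2
  have hcount : (cs.rightInvSeq (ω'.concat i)).count (cs.simple i) = 1 := by
    rw [rightInvSeq_concat, List.concat_eq_append, List.count_append, List.count_singleton_self,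
      List.count_eq_zero.2, zero_add]
    intro hmem
    obtain ⟨t, ht, h3⟩ := List.mem_map.1 hmem
    have : t = cs.simple i := by
      apply (MulAut.conj (cs.simple i)).injective
      rw [h3]
      simp
    exact hnot (this ▸ ht)
  have hpar := cs.count_rightInvSeq_eq_of_wordProd_eq hprod (cs.simple i)
  rw [hcount, Nat.cast_one] at hpar
  have hmem : cs.simple i ∈ cs.rightInvSeq ω := by
    by_contra hn
    rw [List.count_eq_zero.2 hn] at hpar
    exact absurd hpar (by decide)
  obtain ⟨j, hj, hji⟩ := List.mem_iff_getElem.1 hmem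
  refine ⟨j, by simpa using hj, ?_⟩
  rw [← wordProd_mul_getD_rightInvSeq, List.getD_eq_getElem _ _ hj, hji]

variable {cs} in
/-- A word in `J` for an element of the special subgroup `W_J`. -/
theorem exists_word_of_mem_specialSubgroup {J : Set B} {w : W} (hw : w ∈ specialSubgroup cs J) :
    ∃ ω : List B, (∀ i ∈ ω, i ∈ J) ∧ cs.wordProd ω = w := by
  induction hw using Subgroup.closure_induction_left with
  | one => exact ⟨[], by simp⟩
  | mul_left x hx y hy ih =>
    obtain ⟨j, hj, rfl⟩ := hx
    obtain ⟨ω, h1, h2⟩ := ih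
    exact ⟨j :: ω, by simpa [hj] using h1, by rw [wordProd_cons, h2]⟩
  | inv_mul_cancel x hx y hy ih =>
    obtain ⟨j, hj, rfl⟩ := hx
    obtain ⟨ω, h1, h2⟩ := ih
    exact ⟨j :: ω, by simpa [hj] using h1, by rw [wordProd_cons, h2, cs.inv_simple]⟩

theorem wordProd_mem_specialSubgroup {J : Set B} {ω : List B} (h : ∀ i ∈ ω, i ∈ J) :
    cs.wordProd ω ∈ specialSubgroup cs J := by
  refine Subgroup.list_prod_mem _ fun x hx => ?_
  obtain ⟨i, hi, rfl⟩ := List.mem_map.1 hx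
  exact Subgroup.subset_closure ⟨i, h i hi, rfl⟩

/-- If `m` has minimal length in `m W_J`, then lengths add up along words in `J` that are shortest
among the words in `J` with the same product. -/
theorem length_mul_wordProd {J : Set B} {m : W}
    (hm : ∀ a ∈ specialSubgroup cs J, cs.length m ≤ cs.length (m * a)) (ω : List B)
    (hω : ∀ i ∈ ω, i ∈ J)
    (hmin : ∀ ω' : List B, (∀ i ∈ ω', i ∈ J) → cs.wordProd ω' = cs.wordProd ω →
      ω.length ≤ ω'.length) :
    cs.length (m * cs.wordProd ω) = cs.length m + ω.length := by
  induction ω using List.reverseRecOn with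
  | nil => simp
  | append_singleton ω s ih =>
    have hωJ : ∀ i ∈ ω, i ∈ J := fun i hi => hω i (by simp [hi])
    have hsJ : s ∈ J := hω s (by simp)
    have hp : cs.wordProd (ω ++ [s]) = cs.wordProd ω * cs.simple s := by
      rw [wordProd_append, wordProd_singleton]
    have ih' := ih hωJ (fun ω' h1 h2 => by
      have := hmin (ω' ++ [s]) (by simpa [or_imp, forall_and, hsJ] using h1)
        (by rw [wordProd_append, wordProd_append, h2])
      simpa using this)
    rw [hp, ← mul_assoc, List.length_append, List.length_singleton, ← add_assoc, ← ih']
    by_contra hne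
    have hdesc : cs.IsRightDescent (m * cs.wordProd ω) s := by
      by_contra hd
      exact hne (cs.not_isRightDescent_iff.1 hd)
    obtain ⟨μ, hμ, rfl⟩ := cs.exists_isReduced m
    rw [← wordProd_append] at hdesc
    obtain ⟨j, hj, hje⟩ := cs.exists_eraseIdx_of_isRightDescent hdesc
    rw [wordProd_append] at hje
    -- A letter deleted from μ would give an element of m W_J shorter than m; one deleted from ω
    -- would give a shorter word in J for the same product.
    rcases lt_or_ge j μ.length with hlt | hge
    · rw [List.eraseIdx_append_of_lt_length hlt, wordProd_append] at hje
      have h1 := hm (cs.wordProd ω * cs.simple s * (cs.wordProd ω)⁻¹)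
        (mul_mem (mul_mem (cs.wordProd_mem_specialSubgroup hωJ)
          (Subgroup.subset_closure ⟨s, hsJ, rfl⟩))
          (inv_mem (cs.wordProd_mem_specialSubgroup hωJ)))
      rw [← mul_assoc, ← mul_assoc, hje, mul_inv_cancel_right, hμ.eq] at h1
      have h2 := cs.length_wordProd_le (μ.eraseIdx j)
      have h3 := List.length_eraseIdx_add_one hlt
      omega
    · rw [List.eraseIdx_append_of_length_le hge, wordProd_append, mul_assoc,
        mul_right_inj] at hje
      have h1 := hmin (ω.eraseIdx (j - μ.length))
        (fun i hi => hωJ i ((List.eraseIdx_sublist _ _).subset hi)) (by rw [hp, hje])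
      have h2 := (List.eraseIdx_sublist ω (j - μ.length)).length_le
      simp at h1
      omega

/-- An element `a` of `W_J` has a word in `J` along which lengths add up from `m`, whenever `m` has
minimal length in `m W_J`. -/
theorem exists_word_length_mul {J : Set B} {a : W} (ha : a ∈ specialSubgroup cs J) :
    ∃ ω : List B, (∀ i ∈ ω, i ∈ J) ∧ cs.wordProd ω = a ∧
      ∀ m : W, (∀ b ∈ specialSubgroup cs J, cs.length m ≤ cs.length (m * b)) →
        ∀ ν, ν <+: ω → cs.length (m * cs.wordProd ν) = cs.length m + ν.length := by
  classical
  have hex : ∃ n, ∃ ω : List B, (∀ i ∈ ω, i ∈ J) ∧ cs.wordProd ω = a ∧ ω.length = n := by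
    obtain ⟨ω, h1, h2⟩ := exists_word_of_mem_specialSubgroup ha
    exact ⟨_, ω, h1, h2, rfl⟩
  obtain ⟨ω, h1, h2, h3⟩ := Nat.find_spec hex
  refine ⟨ω, h1, h2, fun m hm ν hν => ?_⟩
  -- A prefix of a shortest word in J is again shortest: a shorter replacement followed by κ would
  -- shorten the whole word.
  obtain ⟨κ, rfl⟩ := hν
  refine cs.length_mul_wordProd hm ν (fun i hi => h1 i (by simp [hi])) fun ω' h4 h5 => ?_
  have h6 := Nat.find_min' hex ⟨ω' ++ κ, by
    intro i hi
    rcases List.mem_append.1 hi with h | h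
    · exact h4 i h
    · exact h1 i (by simp [h]), by rw [← h2, wordProd_append, wordProd_append, h5], rfl⟩
  rw [← h3] at h6
  simpa using h6

end Exchange

end CoxeterSystem

/-! ### Backtracking, circuits and potentials in graphs. -/

namespace SerreGraph

variable {V : Type*} {E : Type*} (G : SerreGraph V E)

/-- A list of edges without backtracking. -/
def Reduced (p : List E) : Prop :=
  p.IsChain fun e f => f ≠ G.inv e

variable {G}

theorem inv_injective : Function.Injective G.inv :=
  Function.LeftInverse.injective G.inv_inv

theorem isPath_append {u v : V} {p q : List E} :
    G.IsPath u (p ++ q) v ↔ ∃ w, G.IsPath u p w ∧ G.IsPath w q v := by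
  induction p generalizing u with
  | nil => simp [IsPath]
  | cons e p ih => simp [IsPath, ih, and_assoc]

theorem isPath_singleton {u v : V} {e : E} :
    G.IsPath u [e] v ↔ G.origin e = u ∧ G.terminus e = v := by
  simp [IsPath]

theorem IsPath.append {u v w : V} {p q : List E} (hp : G.IsPath u p v) (hq : G.IsPath v q w) :
    G.IsPath u (p ++ q) w :=
  isPath_append.2 ⟨v, hp, hq⟩

theorem IsPath.reverse {u v : V} {p : List E} (h : G.IsPath u p v) :
    G.IsPath v (p.map G.inv).reverse u := by
  induction p generalizing u with
  | nil => exact h.symm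
  | cons e p ih =>
    rw [List.map_cons, List.reverse_cons]
    exact (ih h.2).append
      (isPath_singleton.2 ⟨G.origin_inv e, (G.terminus_inv e).trans h.1⟩)

theorem IsPath.remove_backtrack {u v : V} {a b : List E} {e : E}
    (h : G.IsPath u (a ++ e :: G.inv e :: b) v) : G.IsPath u (a ++ b) v := by
  obtain ⟨w, ha, rfl, -, hb⟩ := isPath_append.1 h
  rw [G.terminus_inv] at hb
  exact ha.append hb

theorem exists_backtrack_of_not_reduced {p : List E} (h : ¬ G.Reduced p) :
    ∃ a e b, p = a ++ e :: G.inv e :: b := by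
  simp only [Reduced, List.isChain_iff_forall_rel_of_append_cons_cons, not_forall, not_not] at h
  obtain ⟨e, f, a, b, rfl, rfl⟩ := h
  exact ⟨a, e, b, rfl⟩

theorem Reduced.reverse {p : List E} (h : G.Reduced p) : G.Reduced (p.map G.inv).reverse := by
  rw [Reduced, List.isChain_reverse, List.isChain_map]
  refine h.imp fun e f hef h' => hef ?_
  rw [G.inv_inv] at h'
  exact h'.symm

theorem _root_.List.exists_of_not_nodup_map {α β : Type*} {f : α → β} {l : List α}
    (h : ¬ (l.map f).Nodup) : ∃ a x b y c, l = a ++ x :: (b ++ y :: c) ∧ f x = f y := by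
  induction l with
  | nil => simp at h
  | cons z l ih =>
    rw [List.map_cons, List.nodup_cons, not_and_or, not_not] at h
    rcases h with h | h
    · obtain ⟨y, hy, hyz⟩ := List.mem_map.1 h
      obtain ⟨b, c, rfl⟩ := List.append_of_mem hy
      exact ⟨[], z, b, y, c, rfl, hyz.symm⟩
    · obtain ⟨a, x, b, y, c, rfl, hxy⟩ := ih h
      exact ⟨z :: a, x, b, y, c, rfl, hxy⟩

/-- In a graph without circuits, a closed path without backtracking is trivial. -/
theorem eq_nil_of_reduced (hG : ∀ p, ¬ G.IsCircuit p) {u : V} {p : List E}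
    (hp : G.IsPath u p u) (hr : G.Reduced p) : p = [] := by
  induction hn : p.length using Nat.strong_induction_on generalizing p u with
  | _ n ih =>
    by_contra hne
    have hnd : ¬ (p.map G.terminus).Nodup := fun hnd => hG p ⟨hne, ⟨u, hp⟩, hr, hnd⟩
    obtain ⟨a, x, b, y, c, rfl, hxy⟩ := List.exists_of_not_nodup_map hnd
    obtain ⟨w, -, -, h⟩ := isPath_append.1 hp
    obtain ⟨w', hb, hy, -⟩ := isPath_append.1 h
    -- Between two visits to the same vertex lies a strictly shorter non-empty closed path without
    -- backtracking.
    have hpath : G.IsPath (G.terminus x) (b ++ [y]) (G.terminus x) :=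
      hb.append (isPath_singleton.2 ⟨hy, hxy.symm⟩)
    have hinf : b ++ [y] <:+: a ++ x :: (b ++ y :: c) := ⟨a ++ [x], c, by simp⟩
    have := ih _ (by simp [← hn]; omega) hpath (hr.infix hinf) rfl
    simp at this

/-- In a graph without circuits, the last edge of a path without backtracking lies on every path
with the same extremities. -/
theorem mem_of_reduced_append_singleton (hG : ∀ p, ¬ G.IsCircuit p) {u v : V} {p q : List E}
    {e : E} (hp : G.IsPath u (p ++ [e]) v) (hr : G.Reduced (p ++ [e])) (hq : G.IsPath u q v) :
    e ∈ q := by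
  induction hn : q.length using Nat.strong_induction_on generalizing q with
  | _ n ih =>
    by_cases hqr : G.Reduced q
    · rcases List.eq_nil_or_concat q with rfl | ⟨q', f, rfl⟩
      · cases hq
        simpa using eq_nil_of_reduced hG hp hr
      rw [List.concat_eq_append] at *
      by_contra he
      have hclosed := hp.append hq.reverse
      -- Backtracking in p e q⁻¹ could only occur at the junction, which would force f = e.
      have hred : G.Reduced (p ++ [e] ++ ((q' ++ [f]).map G.inv).reverse) := by
        refine List.IsChain.append hr hqr.reverse ?_
        intro x hx y hy
        simp only [List.getLast?_append, List.getLast?_singleton, Option.mem_def, Option.some.injEq, Option.some_or, List.map_append,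
          List.map_cons, List.map_nil, List.reverse_append, List.reverse_cons, List.reverse_nil,
          List.nil_append, List.singleton_append, List.head?_cons] at hx hy
        subst hx hy
        intro h
        exact he (by simp [inv_injective h])
      simpa using eq_nil_of_reduced hG hclosed hred
    · obtain ⟨a, f, b, rfl⟩ := exists_backtrack_of_not_reduced hqr
      have h := ih _ (by simp [← hn]) hq.remove_backtrack rfl
      rcases List.mem_append.1 h with h | h <;> simp [h]

open Classical in
/-- A graph has no circuits if every edge, counted with orientation, is a coboundary. -/
theorem not_isCircuit_of_potential
    (hG : ∀ e₀, ∃ h : V → ℤ, ∀ e, h (G.terminus e) =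
      h (G.origin e) + ((if e = e₀ then 1 else 0) - if e = G.inv e₀ then 1 else 0))
    (p : List E) : ¬ G.IsCircuit p := by
  rintro ⟨hne, ⟨u, hp⟩, hr, hnd⟩
  obtain ⟨e₀, r, rfl⟩ := List.exists_cons_of_ne_nil hne
  obtain ⟨h, hh⟩ := hG e₀
  have key : ∀ (p : List E) (u v : V), G.IsPath u p v →
      h v = h u + ((p.count e₀ : ℤ) - p.count (G.inv e₀)) := by
    intro p
    induction p with
    | nil => rintro u v rfl; simp
    | cons e p ih =>
      rintro u v ⟨rfl, h2⟩
      rw [ih _ _ h2, hh, List.count_cons, List.count_cons]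
      simp only [beq_iff_eq]
      split_ifs <;> push_cast <;> ring
  have h1 := key _ _ _ hp
  have hnd' := List.Nodup.of_map _ hnd
  have h2 : (e₀ :: r).count e₀ = 1 := List.count_eq_one_of_mem hnd' (by simp)
  -- Directly after e₀ its inverse would be a backtrack; later on, the edge preceding it would end
  -- at the terminus of e₀ a second time.
  have h3 : (e₀ :: r).count (G.inv e₀) = 0 := by
    rw [List.count_eq_zero]
    intro hmem
    rcases List.mem_cons.1 hmem with h' | h'
    · exact G.inv_ne _ h'
    obtain ⟨a, b, rfl⟩ := List.append_of_mem h'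
    rcases List.eq_nil_or_concat a with rfl | ⟨a', f, rfl⟩
    · exact (List.isChain_cons_cons.1 hr).1 rfl
    · obtain ⟨w, hw1, hw2⟩ := isPath_append.1 hp.2
      rw [List.concat_eq_append] at hw1 hnd
      obtain ⟨w', -, hw'⟩ := isPath_append.1 hw1
      have hf : G.terminus f = G.terminus e₀ := by
        rw [(isPath_singleton.1 hw').2, ← hw2.1, G.origin_inv]
      simp [hf] at hnd
  rw [h2, h3] at h1
  simp at h1

end SerreGraph

/-! ### The thin building and retractions centred at a chamber. -/

namespace Building

variable {B : Type*} {W : Type*} [Group W] {M : CoxeterMatrix B} {cs : CoxeterSystem M W}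

/-- The thin building of type `(W, S)`. -/
def thin (cs : CoxeterSystem M W) : Building cs W where
  δ x y := x⁻¹ * y
  nonempty := ⟨1⟩
  δ_eq_one_iff x y := by rw [inv_mul_eq_one]
  δ_of_adj i c' c d h := Or.inl (by rw [← h]; group)
  δ_of_adj_of_length i c' c d h _ := by rw [← h]; group
  exists_adj i c d := ⟨c * cs.simple i, by simp, by simp [mul_assoc]⟩

@[simp]
theorem thin_δ (x y : W) : (thin cs).δ x y = x⁻¹ * y := rfl

variable {C : Type*} (Δ : Building cs C)

theorem δ_self (c : C) : Δ.δ c c = 1 :=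
  (Δ.δ_eq_one_iff c c).2 rfl

theorem δ_mem_symm {J : Set B} {c d : C} (h : Δ.δ c d ∈ specialSubgroup cs J) :
    Δ.δ d c ∈ specialSubgroup cs J := by
  rw [← Res_eq_iff] at h ⊢
  exact h.symm

theorem δ_mem_trans {J : Set B} {c d e : C} (h : Δ.δ c d ∈ specialSubgroup cs J)
    (h' : Δ.δ d e ∈ specialSubgroup cs J) : Δ.δ c e ∈ specialSubgroup cs J := by
  rw [← Res_eq_iff] at h h' ⊢
  exact h.trans h'

/-- The retraction of the building onto `W` centred at the chamber `c₀`. -/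
def retract (c₀ c : C) : W :=
  (Δ.δ c c₀)⁻¹

theorem retract_eq_one_iff {c₀ c : C} : Δ.retract c₀ c = 1 ↔ c = c₀ := by
  rw [retract, inv_eq_one, Δ.δ_eq_one_iff]

theorem retract_of_adj (c₀ : C) {c' c : C} {i : B} (h : Δ.δ c' c = cs.simple i) :
    Δ.retract c₀ c' = Δ.retract c₀ c * cs.simple i ∨ Δ.retract c₀ c' = Δ.retract c₀ c := by
  rcases Δ.δ_of_adj i c' c c₀ h with h | h
  · left; simp [retract, h]
  · right; simp [retract, h]

theorem retract_of_adj_of_length (c₀ : C) {c' c : C} {i : B} (h : Δ.δ c' c = cs.simple i)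
    (hl : cs.length (Δ.retract c₀ c * cs.simple i) = cs.length (Δ.retract c₀ c) + 1) :
    Δ.retract c₀ c' = Δ.retract c₀ c * cs.simple i := by
  rw [retract, retract, Δ.δ_of_adj_of_length i c' c c₀ h, mul_inv_rev, cs.inv_simple]
  rw [retract, cs.length_inv] at hl
  rw [← hl, ← cs.length_inv, mul_inv_rev, cs.inv_simple]

theorem exists_adj_retract (c₀ c : C) (i : B) :
    ∃ c', Δ.δ c' c = cs.simple i ∧ Δ.retract c₀ c' = Δ.retract c₀ c * cs.simple i := by
  obtain ⟨c', h1, h2⟩ := Δ.exists_adj i c c₀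
  exact ⟨c', h1, by simp [retract, h2]⟩

/-- Each step of a gallery of type J multiplies the retraction by a generator in J or leaves it
unchanged. Hence the retraction induces a map of residue graphs. -/
theorem retract_inv_mul_mem (c₀ : C) {J : Set B} {c d : C}
    (h : Δ.δ c d ∈ specialSubgroup cs J) :
    (Δ.retract c₀ c)⁻¹ * Δ.retract c₀ d ∈ specialSubgroup cs J := by
  obtain ⟨ω, hω, hωp⟩ := CoxeterSystem.exists_word_of_mem_specialSubgroup h
  induction ω generalizing c with
  | nil =>
    rw [(Δ.δ_eq_one_iff c d).1 (by rw [← hωp, cs.wordProd_nil])]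
    simp [one_mem]
  | cons i ω ih =>
    have hs : cs.simple i ∈ specialSubgroup cs J :=
      Subgroup.subset_closure ⟨i, hω i (by simp), rfl⟩
    obtain ⟨c', h1, h2⟩ := Δ.exists_adj i c d
    rw [← hωp, cs.wordProd_cons, cs.simple_mul_simple_cancel_left] at h2
    have hω' : ∀ j ∈ ω, j ∈ J := fun j hj => hω j (by simp [hj])
    have h3 := ih (c := c') (by rw [h2]; exact cs.wordProd_mem_specialSubgroup hω') hω' h2.symm
    rcases Δ.retract_of_adj c₀ h1 with h | h
    · rw [h, mul_inv_rev, cs.inv_simple, mul_assoc] at h3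
      exact ((specialSubgroup cs J).mul_mem_cancel_left hs).1 h3
    · rwa [h] at h3

/-- Galleries of W lift through the retraction, one letter at a time, from any starting chamber. -/
theorem exists_retract_eq_mul (c₀ c : C) {J : Set B} {a : W} (ha : a ∈ specialSubgroup cs J) :
    ∃ d, Δ.δ c d ∈ specialSubgroup cs J ∧ Δ.retract c₀ d = Δ.retract c₀ c * a := by
  obtain ⟨ω, hω, rfl⟩ := CoxeterSystem.exists_word_of_mem_specialSubgroup ha
  clear ha
  induction ω generalizing c with
  | nil => exact ⟨c, by simp [δ_self, one_mem], by simp⟩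
  | cons i ω ih =>
    obtain ⟨c', h1, h2⟩ := Δ.exists_adj_retract c₀ c i
    obtain ⟨d, h3, h4⟩ := ih c' fun j hj => hω j (by simp [hj])
    refine ⟨d, Δ.δ_mem_trans (Δ.δ_mem_symm ?_) h3, by rw [h4, h2, cs.wordProd_cons, mul_assoc]⟩
    rw [h1]
    exact Subgroup.subset_closure ⟨i, hω i (by simp), rfl⟩

/-- A residue contains at most one chamber whose retraction is a given element of minimal length
in its coset. -/
theorem eq_of_retract_eq (c₀ : C) {J : Set B} {c d : C} (hcd : Δ.δ c d ∈ specialSubgroup cs J)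
    (h : Δ.retract c₀ c = Δ.retract c₀ d)
    (hmin : ∀ a ∈ specialSubgroup cs J,
      cs.length (Δ.retract c₀ c) ≤ cs.length (Δ.retract c₀ c * a)) : c = d := by
  -- While lengths increase along ω, the building axiom forces the retraction to move at every step,
  -- so the retractions centred at c₀ and at c differ by left multiplication by `Δ.retract c₀ c`.
  have key : ∀ (ω : List B), (∀ ν, ν <+: ω → cs.length (Δ.retract c₀ c * cs.wordProd ν) =
        cs.length (Δ.retract c₀ c) + ν.length) →
      ∀ x, Δ.retract c x = cs.wordProd ω →
        Δ.retract c₀ x = Δ.retract c₀ c * cs.wordProd ω := by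
    intro ω
    induction ω using List.reverseRecOn with
    | nil =>
      intro _ x hx
      rw [cs.wordProd_nil, retract_eq_one_iff] at hx
      rw [hx, cs.wordProd_nil, mul_one]
    | append_singleton ω s ih =>
      intro hl x hx
      have hlω := hl ω (List.prefix_append _ _)
      have hlωs := hl _ List.prefix_rfl
      rw [cs.wordProd_append, cs.wordProd_singleton] at hx hlωs ⊢
      obtain ⟨x', h1, h2⟩ := Δ.exists_adj_retract c x s
      rw [hx, cs.simple_mul_simple_cancel_right] at h2
      have h3 := ih (fun ν hν => hl ν (hν.trans (List.prefix_append _ _))) x' h2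
      rcases Δ.retract_of_adj c₀ h1 with h4 | h4
      · rw [← mul_assoc, ← h3, h4, cs.simple_mul_simple_cancel_right]
      · have h5 := Δ.retract_of_adj_of_length c₀ h1 (by
          rw [← h4, h3, mul_assoc, hlωs, hlω, List.length_append, List.length_singleton, add_assoc])
        rw [h4, left_eq_mul] at h5
        have := cs.length_simple s
        rw [h5, cs.length_one] at this
        omega
  have hmem : Δ.retract c d ∈ specialSubgroup cs J := inv_mem (Δ.δ_mem_symm hcd)
  obtain ⟨ω, -, hω, hl⟩ := cs.exists_word_length_mul hmem
  have h1 := key ω (hl _ hmin) d hω.symm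
  rw [← h, left_eq_mul, hω, retract_eq_one_iff] at h1
  exact h1.symm

end Building

/-! ### Residues of chambers as vertices and edges; connectedness. -/

namespace SpecialGraph

variable {B : Type*} {W : Type*} [Group W] {M : CoxeterMatrix B} {cs : CoxeterSystem M W}
  {C : Type*} {V E : Type*} {Λ : SerreGraph V E} (𝒢 : SpecialGraph B Λ) (Δ : Building cs C)

/-- The vertex `Res_{S_v}(c)` of the residue graph, in the copy indexed by `v`. -/
def vtx (v : V) (c : C) : 𝒢.ResidueVertex Δ Set.univ :=
  ⟨v, Δ.Res (𝒢.vset v) c, c, Set.mem_univ c, rfl⟩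

/-- The edge `Res_{S_e}(c)` of the residue graph, in the copy indexed by `e`. -/
def edg (e : E) (c : C) : 𝒢.ResidueEdge Δ Set.univ :=
  ⟨e, Δ.Res (𝒢.eset e) c, c, Set.mem_univ c, rfl⟩

variable {𝒢 Δ}

theorem vtx_eq_iff {v v' : V} {c c' : C} :
    𝒢.vtx Δ v c = 𝒢.vtx Δ v' c' ↔ v = v' ∧ Δ.δ c c' ∈ specialSubgroup cs (𝒢.vset v) := by
  constructor
  · intro h
    obtain rfl : v = v' := congrArg Sigma.fst h
    refine ⟨rfl, Δ.Res_eq_iff.1 ?_⟩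
    exact congrArg Subtype.val (eq_of_heq (Sigma.mk.inj h).2)
  · rintro ⟨rfl, h⟩
    exact residue_sigma_ext (P := fun v => Δ.residues (𝒢.vset v) Set.univ) rfl
      (Δ.Res_eq_of_δ_mem h)

theorem edg_eq_iff {e e' : E} {c c' : C} :
    𝒢.edg Δ e c = 𝒢.edg Δ e' c' ↔ e = e' ∧ Δ.δ c c' ∈ specialSubgroup cs (𝒢.eset e) := by
  constructor
  · intro h
    obtain rfl : e = e' := congrArg Sigma.fst h
    refine ⟨rfl, Δ.Res_eq_iff.1 ?_⟩
    exact congrArg Subtype.val (eq_of_heq (Sigma.mk.inj h).2)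
  · rintro ⟨rfl, h⟩
    exact residue_sigma_ext (P := fun e => Δ.residues (𝒢.eset e) Set.univ) rfl
      (Δ.Res_eq_of_δ_mem h)

@[simp]
theorem origin_edg (e : E) (c : C) :
    (𝒢.residueGraph Δ Set.univ).origin (𝒢.edg Δ e c) = 𝒢.vtx Δ (Λ.origin e) c :=
  residue_sigma_ext (P := fun v => Δ.residues (𝒢.vset v) Set.univ) rfl
    (Δ.enlarge_Res (𝒢.eset_subset_origin e) c)

@[simp]
theorem terminus_edg (e : E) (c : C) :
    (𝒢.residueGraph Δ Set.univ).terminus (𝒢.edg Δ e c) = 𝒢.vtx Δ (Λ.terminus e) c :=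
  residue_sigma_ext (P := fun v => Δ.residues (𝒢.vset v) Set.univ) rfl
    (Δ.enlarge_Res (𝒢.eset_subset e) c)

@[simp]
theorem inv_edg (e : E) (c : C) :
    (𝒢.residueGraph Δ Set.univ).inv (𝒢.edg Δ e c) = 𝒢.edg Δ (Λ.inv e) c :=
  residue_sigma_ext (P := fun e => Δ.residues (𝒢.eset e) Set.univ) rfl
    (by rw [𝒢.eset_inv]; rfl)

theorem exists_eq_vtx (x : 𝒢.ResidueVertex Δ Set.univ) : ∃ v c, x = 𝒢.vtx Δ v c := by
  obtain ⟨v, R, c, -, rfl⟩ := x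
  exact ⟨v, c, rfl⟩

theorem exists_eq_edg (x : 𝒢.ResidueEdge Δ Set.univ) : ∃ e c, x = 𝒢.edg Δ e c := by
  obtain ⟨e, R, c, -, rfl⟩ := x
  exact ⟨e, c, rfl⟩

/-- The paths of `Λ` lift to the residue graph, through the residues of a given chamber. -/
theorem isPath_map_edg {u v : V} {p : List E} (h : Λ.IsPath u p v) (c : C) :
    (𝒢.residueGraph Δ Set.univ).IsPath (𝒢.vtx Δ u c) (p.map fun e => 𝒢.edg Δ e c)
      (𝒢.vtx Δ v c) := by
  induction p generalizing u with
  | nil => cases h; rfl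
  | cons e p ih =>
    obtain ⟨rfl, h⟩ := h
    exact ⟨origin_edg e c, by rw [terminus_edg]; exact ih h⟩

/-- The residues of one chamber carry a copy of the connected graph Λ. If sᵢ-adjacent chambers are
given, their copies share the vertex of any type x with i ∈ S_x, so galleries connect all copies. -/
theorem residueGraph_connected (hS : (⋃ v, 𝒢.vset v) = Set.univ) :
    (𝒢.residueGraph Δ Set.univ).Connected := by
  obtain ⟨v₀⟩ := 𝒢.connected.1
  obtain ⟨c₀⟩ := Δ.nonempty
  refine ⟨⟨𝒢.vtx Δ v₀ c₀⟩, ?_⟩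
  have key : ∀ (ω : List B) (c d : C), Δ.δ c d = cs.wordProd ω → ∀ u v,
      ∃ p, (𝒢.residueGraph Δ Set.univ).IsPath (𝒢.vtx Δ u c) p (𝒢.vtx Δ v d) := by
    intro ω
    induction ω with
    | nil =>
      intro c d h u v
      obtain rfl := (Δ.δ_eq_one_iff c d).1 h
      obtain ⟨p, hp⟩ := 𝒢.connected.2 u v
      exact ⟨_, isPath_map_edg hp c⟩
    | cons i ω ih =>
      intro c d h u v
      obtain ⟨c', h1, h2⟩ := Δ.exists_adj i c d
      rw [h, cs.wordProd_cons, cs.simple_mul_simple_cancel_left] at h2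
      obtain ⟨x, hx⟩ := Set.mem_iUnion.1 (hS ▸ Set.mem_univ i)
      obtain ⟨p, hp⟩ := 𝒢.connected.2 u x
      obtain ⟨q, hq⟩ := ih c' d h2 x v
      refine ⟨_, (isPath_map_edg hp c).append (?_ : SerreGraph.IsPath _ _ q _)⟩
      have : 𝒢.vtx Δ x c = 𝒢.vtx Δ x c' := by
        refine vtx_eq_iff.2 ⟨rfl, Δ.δ_mem_symm ?_⟩
        rw [h1]
        exact Subgroup.subset_closure ⟨i, hx, rfl⟩
      rwa [this]
  intro x y
  obtain ⟨u, c, rfl⟩ := exists_eq_vtx x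
  obtain ⟨v, d, rfl⟩ := exists_eq_vtx y
  obtain ⟨ω, hω⟩ := cs.wordProd_surjective (Δ.δ c d)
  exact key ω c d hω.symm u v

end SpecialGraph

namespace SpecialGraph

variable {B : Type*} {W : Type*} [Group W] {M : CoxeterMatrix B} {cs : CoxeterSystem M W}
  {C : Type*} {V E : Type*} {Λ : SerreGraph V E} {𝒢 : SpecialGraph B Λ} {Δ : Building cs C}

/-! #### Words along paths -/

@[simp]
theorem pathTau_vertexElt (v : V) (a : specialSubgroup cs (𝒢.vset v)) :
    𝒢.pathTau cs (𝒢.vertexElt cs v a) = a :=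
  𝒢.preTau_preVertex cs v a

@[simp]
theorem pathTau_edgeElt (e : E) : 𝒢.pathTau cs (𝒢.edgeElt cs e) = 1 :=
  𝒢.preTau_preEdge cs e

-- Words with trivial vertex letters serve as connecting words invisible to τ, in the role usually
-- played by a maximal tree.
variable (𝒢 cs) in
theorem exists_isPathWord (u v : V) :
    ∃ y, 𝒢.IsPathWord cs u v y ∧ 𝒢.pathTau cs y = 1 := by
  obtain ⟨p, hp⟩ := 𝒢.connected.2 u v
  induction p generalizing u with
  | nil =>
    cases hp
    exact ⟨_, .nil _ 1, by rw [pathTau_vertexElt, OneMemClass.coe_one]⟩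
  | cons e p ih =>
    obtain ⟨rfl, hp⟩ := hp
    obtain ⟨y, h1, h2⟩ := ih _ hp
    exact ⟨_, .cons e 1 _ y h1, by simp [h2]⟩

theorem IsPathWord.edge (𝒢 : SpecialGraph B Λ) (cs : CoxeterSystem M W) (e : E) :
    𝒢.IsPathWord cs (Λ.origin e) (Λ.terminus e) (𝒢.edgeElt cs e) := by
  simpa using (IsPathWord.edge_inv 𝒢 cs e).inv

theorem edgeElt_mul_vertexElt (e : E) {a : W} (ha : a ∈ specialSubgroup cs (𝒢.eset e)) :
    𝒢.edgeElt cs e *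
        𝒢.vertexElt cs (Λ.terminus e) ⟨a, specialSubgroup_mono cs (𝒢.eset_subset e) ha⟩ *
        (𝒢.edgeElt cs e)⁻¹ =
      𝒢.vertexElt cs (Λ.origin e) ⟨a, specialSubgroup_mono cs (𝒢.eset_subset_origin e) ha⟩ := by
  rw [← mul_inv_eq_one]
  exact (QuotientGroup.eq_one_iff _).2
    (Subgroup.subset_normalClosure (Or.inr ⟨e, a, ha, rfl⟩))

theorem IsPathWord.pathTau_mem {u v : V} {x : 𝒢.PathGroup cs} (h : 𝒢.IsPathWord cs u v x) :
    𝒢.pathTau cs x ∈ specialSubgroup cs (⋃ v, 𝒢.vset v) := by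
  have hv (v : V) (a : specialSubgroup cs (𝒢.vset v)) :
      (a : W) ∈ specialSubgroup cs (⋃ v, 𝒢.vset v) :=
    specialSubgroup_mono cs (Set.subset_iUnion _ v) a.2
  induction h with
  | nil v a => simpa using hv v a
  | cons e a w x h ih =>
    rw [map_mul, map_mul, pathTau_vertexElt, pathTau_edgeElt, mul_one]
    exact mul_mem (hv _ a) ih

theorem iUnion_vset_eq_univ {x₀ : V} (h : Function.Surjective (𝒢.tau cs x₀)) :
    (⋃ v, 𝒢.vset v) = Set.univ := by
  refine Set.eq_univ_of_forall fun i => ?_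
  obtain ⟨⟨x, hx⟩, hxi⟩ := h (cs.simple i)
  refine cs.mem_of_simple_mem_specialSubgroup (hxi ▸ ?_)
  exact IsPathWord.pathTau_mem hx

theorem tau_surjective (h : (⋃ v, 𝒢.vset v) = Set.univ) (x₀ : V) :
    Function.Surjective (𝒢.tau cs x₀) := by
  rw [← MonoidHom.range_eq_top, eq_top_iff, ← cs.subgroup_closure_range_simple,
    Subgroup.closure_le]
  rintro _ ⟨i, rfl⟩
  obtain ⟨v, hv⟩ := Set.mem_iUnion.1 (h ▸ Set.mem_univ i)
  obtain ⟨y, h1, h2⟩ := 𝒢.exists_isPathWord cs x₀ v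
  refine ⟨⟨_, (h1.mul (.nil v ⟨cs.simple i, Subgroup.subset_closure ⟨i, hv, rfl⟩⟩)).mul h1.inv⟩, ?_⟩
  simp [tau, h2]

/-! #### Potentials -/

section Potential

variable {A : Type*} [CommGroup A]

variable (W A) in
/-- The action of `W` on functions on `W` by right translation. -/
def rightTranslate : W →* MulAut (W → A) where
  toFun a :=
    { toFun := fun n w => n (w * a)
      invFun := fun n w => n (w * a⁻¹)
      left_inv := fun n => by ext w; simp
      right_inv := fun n => by ext w; simp
      map_mul' := fun _ _ => rfl }
  map_one' := by ext n w; simp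
  map_mul' a b := by ext n w; simp [mul_assoc]

@[simp]
theorem rightTranslate_apply (a : W) (n : W → A) (w : W) :
    rightTranslate W A a n w = n (w * a) := rfl

variable (𝒢 cs) in
/-- The homomorphism from the free product to `Fun(W, A) ⋊ W` that extends the inclusions of the
vertex groups and sends the edge `e` to `f e`. -/
def preHolonomy (f : E → W → A) : 𝒢.FreeProd cs →* (W → A) ⋊[rightTranslate W A] W :=
  Monoid.Coprod.lift
    (Monoid.CoprodI.lift fun v : V =>
      SemidirectProduct.inr.comp (specialSubgroup cs (𝒢.vset v)).subtype)
    (FreeGroup.lift fun e => SemidirectProduct.inl (f e))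

theorem preHolonomy_preVertex (f : E → W → A) (v : V) (a : specialSubgroup cs (𝒢.vset v)) :
    𝒢.preHolonomy cs f (𝒢.preVertex cs v a) = SemidirectProduct.inr (a : W) := by
  simp [preHolonomy, preVertex]

theorem preHolonomy_preEdge (f : E → W → A) (e : E) :
    𝒢.preHolonomy cs f (𝒢.preEdge cs e) = SemidirectProduct.inl (f e) := by
  simp [preHolonomy, preEdge]

/-- The relation e a e⁻¹ = a becomes right invariance of f e under the edge group. On a path word,
the function component of Φ at w is the product of the values of f along the lifted path starting at
w. -/
theorem exists_holonomy {f : E → W → A} (hinv : ∀ e, f (Λ.inv e) = (f e)⁻¹)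
    (hf : ∀ e w, ∀ a ∈ specialSubgroup cs (𝒢.eset e), f e (w * a) = f e w) :
    ∃ Φ : 𝒢.PathGroup cs →* (W → A) ⋊[rightTranslate W A] W,
      (∀ v a, Φ (𝒢.vertexElt cs v a) = SemidirectProduct.inr (a : W)) ∧
      (∀ e, Φ (𝒢.edgeElt cs e) = SemidirectProduct.inl (f e)) ∧
      ∀ x, (Φ x).right = 𝒢.pathTau cs x := by
  have hker : Subgroup.normalClosure (𝒢.relators cs) ≤ (𝒢.preHolonomy cs f).ker := by
    refine Subgroup.normalClosure_le_normal ?_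
    rintro x (⟨e, rfl⟩ | ⟨e, a, ha, rfl⟩)
    · simp [MonoidHom.mem_ker, preHolonomy_preEdge, hinv]
    · rw [SetLike.mem_coe, MonoidHom.mem_ker, map_mul, map_mul, map_mul, map_inv, map_inv,
        preHolonomy_preEdge, preHolonomy_preVertex, preHolonomy_preVertex, mul_inv_eq_one,
        mul_inv_eq_iff_eq_mul]
      ext w
      · simp [hf e w a ha]
      · simp
  refine ⟨QuotientGroup.lift _ (𝒢.preHolonomy cs f) hker, fun v a => ?_, fun e => ?_, fun x => ?_⟩
  · exact preHolonomy_preVertex (𝒢 := 𝒢) f v a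
  · exact preHolonomy_preEdge (𝒢 := 𝒢) (cs := cs) f e
  · obtain ⟨x, rfl⟩ := QuotientGroup.mk_surjective x
    have : SemidirectProduct.rightHom.comp (𝒢.preHolonomy cs f) = 𝒢.preTau cs := by
      ext
      · simp [preHolonomy, preTau]
      · simp [preHolonomy, preTau]
    exact DFunLike.congr_fun this x

/-- If `τ` is an isomorphism, then the first cohomology of the residue graph of the thin building
vanishes. -/
theorem exists_potential {x₀ : V} (hτ : Function.Bijective (𝒢.tau cs x₀)) {f : E → W → A}
    (hinv : ∀ e, f (Λ.inv e) = (f e)⁻¹)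
    (hf : ∀ e w, ∀ a ∈ specialSubgroup cs (𝒢.eset e), f e (w * a) = f e w) :
    ∃ h : V → W → A, (∀ v w, ∀ a ∈ specialSubgroup cs (𝒢.vset v), h v (w * a) = h v w) ∧
      ∀ e w, h (Λ.terminus e) w = h (Λ.origin e) w * f e w := by
  obtain ⟨Φ, hΦv, hΦe, hΦr⟩ := exists_holonomy hinv hf
  choose P hP hPτ using 𝒢.exists_isPathWord cs x₀
  have hsurj : ∀ w : W, ∃ y, 𝒢.IsPathWord cs x₀ x₀ y ∧ 𝒢.pathTau cs y = w := by
    intro w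
    obtain ⟨⟨y, hy⟩, rfl⟩ := hτ.2 w
    exact ⟨y, hy, rfl⟩
  have hinj : ∀ y y', 𝒢.IsPathWord cs x₀ x₀ y → 𝒢.IsPathWord cs x₀ x₀ y' →
      𝒢.pathTau cs y = 𝒢.pathTau cs y' → y = y' := by
    intro y y' hy hy' h
    exact congrArg Subtype.val (hτ.1 (a₁ := ⟨y, hy⟩) (a₂ := ⟨y', hy'⟩) h)
  choose Y hY hYτ using hsurj
  have hPr (v : V) : (Φ (P v)).right = 1 := by rw [hΦr, hPτ]
  have hYr (w : W) : (Φ (Y w)).right = w := by rw [hΦr, hYτ]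
  -- This is the function component of Φ (Y w * P v) at 1: the product of f along a path from the
  -- base vertex to the residue of w of type v. Both properties compare two words with the same
  -- image under τ, equal by injectivity.
  refine ⟨fun v w => (Φ (Y w)).left 1 * (Φ (P v)).left w, fun v w a ha => ?_, fun e w => ?_⟩
  · have hy := hinj _ _ (hY (w * a))
      ((hY w).mul (((hP v).mul (.nil v ⟨a, ha⟩)).mul (hP v).inv)) (by simp [hYτ, hPτ])
    beta_reduce
    rw [hy]
    simp [hPr, hYr, hΦv, mul_assoc]
  · have hy := hinj _ 1 (((hP (Λ.origin e)).mul (IsPathWord.edge 𝒢 cs e)).mul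
      (hP (Λ.terminus e)).inv) (𝒢.fundamentalGroup cs x₀).one_mem (by simp [hPτ])
    rw [mul_inv_eq_one] at hy
    beta_reduce
    rw [← hy]
    simp [hPr, hΦe, mul_assoc]

/-- If `τ` is an isomorphism, then the residue graph of the thin building has no circuits. -/
theorem thin_not_isCircuit {x₀ : V} (hτ : Function.Bijective (𝒢.tau cs x₀)) :
    ∀ p, ¬ (𝒢.residueGraph (Building.thin cs) Set.univ).IsCircuit p := by
  classical
  refine SerreGraph.not_isCircuit_of_potential fun ε => ?_
  set G := 𝒢.residueGraph (Building.thin cs) Set.univ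
  -- The signed indicator of the oriented edge ε, written multiplicatively to fit the semidirect
  -- product.
  let f : E → W → Multiplicative ℤ := fun e w =>
    Multiplicative.ofAdd ((if 𝒢.edg (Building.thin cs) e w = ε then 1 else 0) -
      if 𝒢.edg (Building.thin cs) e w = G.inv ε then 1 else 0)
  have hinv_iff (x y) : G.inv x = y ↔ x = G.inv y :=
    ⟨fun h => by rw [← h, G.inv_inv], fun h => by rw [h, G.inv_inv]⟩
  obtain ⟨h, h1, h2⟩ := exists_potential hτ (f := f)
    (fun e => by
      ext w
      simp only [f, Pi.inv_apply, ← inv_edg, ← ofAdd_neg, neg_sub]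
      have e1 := hinv_iff (𝒢.edg _ e w) ε
      have e2 := hinv_iff (𝒢.edg _ e w) (G.inv ε)
      rw [G.inv_inv] at e2
      simp only [G] at e1 e2 ⊢
      simp only [e1, e2])
    (fun e w a ha => by
      have : 𝒢.edg (Building.thin cs) e (w * a) = 𝒢.edg (Building.thin cs) e w :=
        edg_eq_iff.2 ⟨rfl, by simpa using ha⟩
      simp only [f, this])
  -- By invariance the potential descends from W to the residues, whatever representative is chosen.
  have hrep (v : V) (w : W) :
      h v (Classical.choose (𝒢.vtx (Building.thin cs) v w).2.2) = h v w := by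
    have hspec := (Classical.choose_spec (𝒢.vtx (Building.thin cs) v w).2.2).2
    have := h1 v w _ (Building.δ_mem_symm _ ((Building.thin cs).Res_eq_iff.1 hspec))
    rwa [Building.thin_δ, mul_inv_cancel_left] at this
  refine ⟨fun x => (h x.1 (Classical.choose x.2.2)).toAdd, fun x => ?_⟩
  obtain ⟨e, w, rfl⟩ := exists_eq_edg x
  rw [origin_edg, terminus_edg]
  change (h (Λ.terminus e) _).toAdd = (h (Λ.origin e) _).toAdd + _
  rw [hrep, hrep, h2, toAdd_mul]
  simp only [f, toAdd_ofAdd]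
  congr!

end Potential

/-! #### The retraction of the residue graph -/

variable (𝒢 Δ) in
/-- The map induced by the retraction centred at `c₀` on the vertices of the residue graphs. -/
noncomputable def retractVertex (c₀ : C) (x : 𝒢.ResidueVertex Δ Set.univ) :
    𝒢.ResidueVertex (Building.thin cs) Set.univ :=
  𝒢.vtx (Building.thin cs) x.1 (Δ.retract c₀ (Classical.choose x.2.2))

variable (𝒢 Δ) in
/-- The map induced by the retraction centred at `c₀` on the edges of the residue graphs. -/
noncomputable def retractEdge (c₀ : C) (x : 𝒢.ResidueEdge Δ Set.univ) :
    𝒢.ResidueEdge (Building.thin cs) Set.univ :=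
  𝒢.edg (Building.thin cs) x.1 (Δ.retract c₀ (Classical.choose x.2.2))

theorem retractVertex_vtx (c₀ : C) (v : V) (c : C) :
    𝒢.retractVertex Δ c₀ (𝒢.vtx Δ v c) = 𝒢.vtx (Building.thin cs) v (Δ.retract c₀ c) :=
  vtx_eq_iff.2 ⟨rfl, Δ.retract_inv_mul_mem c₀
    (Δ.Res_eq_iff.1 (Classical.choose_spec (𝒢.vtx Δ v c).2.2).2)⟩

theorem retractEdge_edg (c₀ : C) (e : E) (c : C) :
    𝒢.retractEdge Δ c₀ (𝒢.edg Δ e c) = 𝒢.edg (Building.thin cs) e (Δ.retract c₀ c) :=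
  edg_eq_iff.2 ⟨rfl, Δ.retract_inv_mul_mem c₀
    (Δ.Res_eq_iff.1 (Classical.choose_spec (𝒢.edg Δ e c).2.2).2)⟩

theorem isPath_map_retractEdge (c₀ : C) {x y : 𝒢.ResidueVertex Δ Set.univ}
    {p : List (𝒢.ResidueEdge Δ Set.univ)} (h : (𝒢.residueGraph Δ Set.univ).IsPath x p y) :
    (𝒢.residueGraph (Building.thin cs) Set.univ).IsPath (𝒢.retractVertex Δ c₀ x)
      (p.map (𝒢.retractEdge Δ c₀)) (𝒢.retractVertex Δ c₀ y) := by
  induction p generalizing x with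
  | nil => cases h; rfl
  | cons ε p ih =>
    obtain ⟨e, c, rfl⟩ := exists_eq_edg ε
    obtain ⟨rfl, h⟩ := h
    refine ⟨?_, ?_⟩
    · rw [retractEdge_edg, origin_edg, origin_edg, retractVertex_vtx]
    · have := ih h
      rwa [terminus_edg, retractVertex_vtx, ← terminus_edg, ← retractEdge_edg] at this

/-- Any vertex of the residue graph of the thin building can be reached by a path through
residues of elements that are not longer than a given representative. -/
theorem exists_isPath_length_lt (hS : (⋃ v, 𝒢.vset v) = Set.univ) (u v : V) (m : W) :
    ∃ q, (𝒢.residueGraph (Building.thin cs) Set.univ).IsPath (𝒢.vtx (Building.thin cs) u 1) q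
        (𝒢.vtx (Building.thin cs) v m) ∧
      ∀ ε ∈ q, ∃ e w, ε = 𝒢.edg (Building.thin cs) e w ∧
        (w = m ∨ cs.length w < cs.length m) := by
  induction hn : cs.length m using Nat.strong_induction_on generalizing m v with
  | _ n ih =>
    by_cases hm : m = 1
    · subst hm
      obtain ⟨p, hp⟩ := 𝒢.connected.2 u v
      refine ⟨_, isPath_map_edg hp 1, fun ε hε => ?_⟩
      obtain ⟨e, -, rfl⟩ := List.mem_map.1 hε
      exact ⟨e, 1, rfl, Or.inl rfl⟩
    -- For a descent i of m and i ∈ S_x, the elements m and m sᵢ share the vertex of type x: reach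
    -- it through shorter elements, then move inside the copy of Λ at m.
    · obtain ⟨i, hi⟩ := cs.exists_rightDescent_of_ne_one hm
      obtain ⟨x, hx⟩ := Set.mem_iUnion.1 (hS ▸ Set.mem_univ i)
      obtain ⟨q, hq, hq'⟩ := ih _ (hn ▸ hi) x (m * cs.simple i) rfl
      obtain ⟨p, hp⟩ := 𝒢.connected.2 x v
      have hvtx : 𝒢.vtx (Building.thin cs) x (m * cs.simple i) = 𝒢.vtx (Building.thin cs) x m :=
        vtx_eq_iff.2 ⟨rfl, by
          have hs : cs.simple i ∈ specialSubgroup cs (𝒢.vset x) :=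
            Subgroup.subset_closure ⟨i, hx, rfl⟩
          rwa [Building.thin_δ, mul_inv_rev, inv_mul_cancel_right, cs.inv_simple]⟩
      rw [hvtx] at hq
      refine ⟨_, hq.append (isPath_map_edg hp m), fun ε hε => ?_⟩
      rcases List.mem_append.1 hε with hε | hε
      · obtain ⟨e, w, h1, h2⟩ := hq' ε hε
        refine ⟨e, w, h1, Or.inr (hn ▸ ?_)⟩
        rcases h2 with rfl | h2
        · exact hi
        · exact h2.trans hi
      · obtain ⟨e, -, rfl⟩ := List.mem_map.1 hε
        exact ⟨e, m, rfl, Or.inl rfl⟩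

/-- The last edge of a path without backtracking in the residue graph of the thin building
contains the element of minimal length of the last vertex. -/
theorem last_edge_eq (hT : ∀ p, ¬ (𝒢.residueGraph (Building.thin cs) Set.univ).IsCircuit p)
    (hS : (⋃ v, 𝒢.vset v) = Set.univ) {u v : V} {m : W}
    (hm : ∀ a ∈ specialSubgroup cs (𝒢.vset v), cs.length m ≤ cs.length (m * a))
    {p : List (𝒢.ResidueEdge (Building.thin cs) Set.univ)}
    {ε : 𝒢.ResidueEdge (Building.thin cs) Set.univ}
    (hp : (𝒢.residueGraph (Building.thin cs) Set.univ).IsPath (𝒢.vtx (Building.thin cs) u 1)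
      (p ++ [ε]) (𝒢.vtx (Building.thin cs) v m))
    (hr : (𝒢.residueGraph (Building.thin cs) Set.univ).Reduced (p ++ [ε])) :
    ∃ e, ε = 𝒢.edg (Building.thin cs) e m := by
  -- In the absence of circuits the last edge must lie on this path too. It ends at the coset of m,
  -- so a representative w strictly shorter than m would contradict minimality.
  obtain ⟨q, hq, hq'⟩ := exists_isPath_length_lt hS u v m
  obtain ⟨e, w, rfl, hw⟩ := hq' ε (SerreGraph.mem_of_reduced_append_singleton hT hp hr hq)
  refine ⟨e, ?_⟩
  rcases hw with rfl | hw
  · rfl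
  obtain ⟨x, -, hx⟩ := SerreGraph.isPath_append.1 hp
  have h1 := (SerreGraph.isPath_singleton.1 hx).2
  rw [terminus_edg] at h1
  obtain ⟨rfl, h2⟩ := vtx_eq_iff.1 h1.symm
  have := hm _ h2
  rw [Building.thin_δ, mul_inv_cancel_left] at this
  omega

/-- The retraction centred at `c₀` preserves the absence of backtracking along paths that start at
a residue of `c₀`. -/
theorem reduced_map_retractEdge
    (hT : ∀ p, ¬ (𝒢.residueGraph (Building.thin cs) Set.univ).IsCircuit p)
    (hS : (⋃ v, 𝒢.vset v) = Set.univ) (c₀ : C) {u : V} {y : 𝒢.ResidueVertex Δ Set.univ}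
    {p : List (𝒢.ResidueEdge Δ Set.univ)}
    (hp : (𝒢.residueGraph Δ Set.univ).IsPath (𝒢.vtx Δ u c₀) p y)
    (hr : (𝒢.residueGraph Δ Set.univ).Reduced p) :
    (𝒢.residueGraph (Building.thin cs) Set.univ).Reduced (p.map (𝒢.retractEdge Δ c₀)) := by
  induction p using List.reverseRecOn generalizing y with
  | nil => exact List.IsChain.nil
  | append_singleton p φ ih =>
    obtain ⟨z, hpz, hzφ⟩ := SerreGraph.isPath_append.1 hp
    have ih' := ih hpz (hr.left_of_append)
    rcases List.eq_nil_or_concat p with rfl | ⟨p, ε, rfl⟩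
    · exact List.IsChain.singleton _
    rw [List.concat_eq_append] at *
    rw [List.map_append]
    refine List.IsChain.append ih' (List.IsChain.singleton _) ?_
    intro x hx x' hx'
    simp only [List.map_append, List.map_cons, List.map_nil, List.getLast?_append,
      List.getLast?_singleton, Option.some_or, Option.mem_def, Option.some.injEq,
      List.head?_cons] at hx hx'
    subst hx hx'
    have hne : φ ≠ (𝒢.residueGraph Δ Set.univ).inv ε := by
      rw [List.append_assoc] at hr
      exact (List.isChain_cons_cons.1 hr.right_of_append).1
    intro heq
    apply hne
    obtain ⟨e, c, rfl⟩ := exists_eq_edg ε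
    obtain ⟨f, d, rfl⟩ := exists_eq_edg φ
    rw [retractEdge_edg, retractEdge_edg, inv_edg, edg_eq_iff] at heq
    obtain ⟨rfl, hdc⟩ := heq
    rw [𝒢.eset_inv, Building.thin_δ] at hdc
    rw [inv_edg, edg_eq_iff, 𝒢.eset_inv]
    refine ⟨rfl, Δ.δ_mem_symm ?_⟩
    obtain ⟨z', -, hz'⟩ := SerreGraph.isPath_append.1 hpz
    have hz1 := (SerreGraph.isPath_singleton.1 hz').2
    have hz2 := (SerreGraph.isPath_singleton.1 hzφ).1
    rw [terminus_edg] at hz1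
    rw [← hz1, origin_edg, vtx_eq_iff, Λ.origin_inv] at hz2
    have hdv := hz2.2
    have hsub := specialSubgroup_mono cs (𝒢.eset_subset e)
    -- A shortest element of the coset that is the retraction of the vertex between the two edges.
    obtain ⟨m, ⟨b, hb, rfl⟩, hmin⟩ : ∃ m ∈ {m | ∃ b ∈ specialSubgroup cs (𝒢.vset (Λ.terminus e)),
        m = Δ.retract c₀ c * b}, ∀ m' ∈ {m | ∃ b ∈ specialSubgroup cs (𝒢.vset (Λ.terminus e)),
        m = Δ.retract c₀ c * b}, cs.length m ≤ cs.length m' := by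
      obtain ⟨m, hm, hm'⟩ := WellFounded.has_min (measure cs.length).wf
        {m | ∃ b ∈ specialSubgroup cs (𝒢.vset (Λ.terminus e)), m = Δ.retract c₀ c * b}
        ⟨_, 1, one_mem _, rfl⟩
      exact ⟨m, hm, fun m' h => not_lt.1 (hm' m' h)⟩
    have hmin' : ∀ a ∈ specialSubgroup cs (𝒢.vset (Λ.terminus e)),
        cs.length (Δ.retract c₀ c * b) ≤ cs.length (Δ.retract c₀ c * b * a) :=
      fun a ha => hmin _ ⟨b * a, mul_mem hb ha, mul_assoc _ _ _⟩
    have hpath := isPath_map_retractEdge c₀ hpz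
    have hvtx : 𝒢.vtx (Building.thin cs) (Λ.terminus e) (Δ.retract c₀ c) =
        𝒢.vtx (Building.thin cs) (Λ.terminus e) (Δ.retract c₀ c * b) :=
      vtx_eq_iff.2 ⟨rfl, by simpa using hb⟩
    rw [← hz1, retractVertex_vtx, retractVertex_vtx, Δ.retract_eq_one_iff.2 rfl,
      List.map_append, List.map_singleton, hvtx] at hpath
    rw [List.map_append, List.map_singleton] at ih'
    obtain ⟨e', he'⟩ := last_edge_eq hT hS hmin' hpath ih'
    rw [retractEdge_edg, edg_eq_iff, Building.thin_δ, inv_mul_cancel_left] at he'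
    have hbe := he'.2
    -- The common retracted edge contains the minimal element, so both edges contain a chamber above
    -- it. These chambers lie in one vertex residue, hence coincide, and so do the edge residues.
    obtain ⟨c', hc', hc'm⟩ := Δ.exists_retract_eq_mul c₀ c hbe
    obtain ⟨d', hd', hd'm⟩ := Δ.exists_retract_eq_mul c₀ d (mul_mem hdc hbe)
    rw [mul_assoc, mul_inv_cancel_left] at hd'm
    have hcd : c' = d' := by
      refine Δ.eq_of_retract_eq c₀ (J := 𝒢.vset (Λ.terminus e)) ?_ (hc'm.trans hd'm.symm) ?_
      · exact Δ.δ_mem_trans (Δ.δ_mem_symm (hsub hc'))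
          (Δ.δ_mem_trans (Δ.δ_mem_symm hdv) (hsub hd'))
      · rwa [hc'm]
    subst hcd
    exact Δ.δ_mem_trans hc' (Δ.δ_mem_symm hd')

theorem isTree_of_isVisualDecomposition {x₀ : V} (hτ : 𝒢.IsVisualDecomposition cs x₀) :
    (⋃ v, 𝒢.vset v) = Set.univ ∧ (𝒢.residueGraph Δ Set.univ).IsTree := by
  have hS := iUnion_vset_eq_univ hτ.2
  refine ⟨hS, residueGraph_connected hS, ?_⟩
  rintro p ⟨hne, ⟨x, hp⟩, hr, -⟩
  obtain ⟨u, c₀, rfl⟩ := exists_eq_vtx x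
  have hT := thin_not_isCircuit hτ
  have h1 := reduced_map_retractEdge hT hS c₀ hp hr
  exact hne (List.map_eq_nil_iff.1
    (SerreGraph.eq_nil_of_reduced hT (isPath_map_retractEdge c₀ hp) h1))

/-! #### Words of closed paths in the residue graph -/

open Classical in
variable (𝒢 cs) in
/-- The element of `F(𝒢, Λ)` given by `a ∈ W_{S_v}`, and `1` if `a` is not in `W_{S_v}`. -/
noncomputable def vertexElt' (v : V) (a : W) : 𝒢.PathGroup cs :=
  if h : a ∈ specialSubgroup cs (𝒢.vset v) then 𝒢.vertexElt cs v ⟨a, h⟩ else 1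

theorem vertexElt'_of_mem {v : V} {a : W} (h : a ∈ specialSubgroup cs (𝒢.vset v)) :
    𝒢.vertexElt' cs v a = 𝒢.vertexElt cs v ⟨a, h⟩ :=
  dif_pos h

theorem vertexElt'_mul {v : V} {a b : W} (ha : a ∈ specialSubgroup cs (𝒢.vset v))
    (hb : b ∈ specialSubgroup cs (𝒢.vset v)) :
    𝒢.vertexElt' cs v (a * b) = 𝒢.vertexElt' cs v a * 𝒢.vertexElt' cs v b := by
  rw [vertexElt'_of_mem ha, vertexElt'_of_mem hb, vertexElt'_of_mem (mul_mem ha hb),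
    ← vertexElt_mul]
  rfl

variable (𝒢 cs) in
/-- The word of the path in the residue graph of the thin building that leads from a residue of
`w` to the residue of `w'` of type `v` through the given edges. -/
noncomputable def wordElt (v : V) (w' : W) : W → List (E × W) → 𝒢.PathGroup cs
  | w, [] => 𝒢.vertexElt' cs v (w⁻¹ * w')
  | w, x :: l => 𝒢.vertexElt' cs (Λ.origin x.1) (w⁻¹ * x.2) * 𝒢.edgeElt cs x.1 *
      wordElt v w' x.2 l

/-- Changing the starting element within its vertex coset only alters the first vertex letter, into
which the correction is absorbed. -/
theorem vertexElt'_mul_wordElt {u v : V} {w₀ w w' : W} {l : List (E × W)}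
    (hl : (𝒢.residueGraph (Building.thin cs) Set.univ).IsPath (𝒢.vtx _ u w)
      (l.map fun x => 𝒢.edg _ x.1 x.2) (𝒢.vtx _ v w'))
    (hw : w₀⁻¹ * w ∈ specialSubgroup cs (𝒢.vset u)) :
    𝒢.vertexElt' cs u (w₀⁻¹ * w) * 𝒢.wordElt cs v w' w l = 𝒢.wordElt cs v w' w₀ l := by
  cases l with
  | nil =>
    obtain ⟨rfl, h⟩ := vtx_eq_iff.1 (hl : 𝒢.vtx _ u w = 𝒢.vtx _ v w')
    rw [Building.thin_δ] at h
    rw [wordElt, wordElt, ← vertexElt'_mul hw h]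
    congr 1
    group
  | cons x l =>
    have h1 := hl.1
    rw [origin_edg] at h1
    obtain ⟨rfl, h⟩ := vtx_eq_iff.1 h1.symm
    rw [Building.thin_δ] at h
    rw [wordElt, wordElt, ← mul_assoc, ← mul_assoc, ← vertexElt'_mul hw h]
    congr 3
    group

/-- The backtrack contributes e a e⁻¹ with a = g⁻¹g' in the edge group; the defining relation turns
it into a vertex letter at o(e), which merges with its neighbours. -/
theorem wordElt_remove_backtrack {u v : V} {w w' g g' : W} {a b : List (E × W)} {e : E}
    (hl : (𝒢.residueGraph (Building.thin cs) Set.univ).IsPath (𝒢.vtx _ u w)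
      ((a ++ (e, g) :: (Λ.inv e, g') :: b).map fun x => 𝒢.edg _ x.1 x.2) (𝒢.vtx _ v w'))
    (hg : g⁻¹ * g' ∈ specialSubgroup cs (𝒢.eset e)) :
    𝒢.wordElt cs v w' w (a ++ (e, g) :: (Λ.inv e, g') :: b) =
      𝒢.wordElt cs v w' w (a ++ b) := by
  induction a generalizing u w with
  | nil =>
    obtain ⟨h1, -, h3⟩ := hl
    rw [origin_edg] at h1
    obtain ⟨rfl, h⟩ := vtx_eq_iff.1 h1.symm
    rw [Building.thin_δ] at h
    have hgo := specialSubgroup_mono cs (𝒢.eset_subset_origin e) hg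
    have hgt := specialSubgroup_mono cs (𝒢.eset_subset e) hg
    have hconj := edgeElt_mul_vertexElt e hg
    rw [← vertexElt'_of_mem hgt, ← vertexElt'_of_mem hgo] at hconj
    simp only [terminus_edg, Λ.terminus_inv] at h3
    have hmul : w⁻¹ * g' = w⁻¹ * g * (g⁻¹ * g') := by group
    rw [List.nil_append, List.nil_append,
      ← vertexElt'_mul_wordElt h3 (w₀ := w) (by rw [hmul]; exact mul_mem h hgo), hmul,
      vertexElt'_mul h hgo, ← hconj, wordElt, wordElt, Λ.origin_inv, edgeElt_inv]
    simp only [mul_assoc]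
  | cons x a ih =>
    obtain ⟨-, h2⟩ := hl
    rw [terminus_edg] at h2
    rw [List.cons_append, List.cons_append, wordElt, wordElt, ih h2]

/-- Every word along a path is the word of a path in the residue graph of a building. -/
theorem IsPathWord.exists_isPath {u v : V} {x : 𝒢.PathGroup cs} (hx : 𝒢.IsPathWord cs u v x)
    (Δ : Building cs C) (c₀ c : C) :
    ∃ (q : List (E × C)) (c' : C),
      (𝒢.residueGraph Δ Set.univ).IsPath (𝒢.vtx Δ u c) (q.map fun x => 𝒢.edg Δ x.1 x.2)
        (𝒢.vtx Δ v c') ∧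
      𝒢.wordElt cs v (Δ.retract c₀ c') (Δ.retract c₀ c)
        (q.map (Prod.map id (Δ.retract c₀))) = x ∧
      Δ.retract c₀ c' = Δ.retract c₀ c * 𝒢.pathTau cs x := by
  induction hx generalizing c with
  | nil v a =>
    obtain ⟨c', h1, h2⟩ := Δ.exists_retract_eq_mul c₀ c a.2
    refine ⟨[], c', vtx_eq_iff.2 ⟨rfl, h1⟩, ?_, by rw [h2, pathTau_vertexElt]⟩
    rw [List.map_nil, wordElt, h2, inv_mul_cancel_left, vertexElt'_of_mem a.2]
  | cons e a w x h ih =>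
    obtain ⟨d, h1, h2⟩ := Δ.exists_retract_eq_mul c₀ c a.2
    obtain ⟨q, c', h3, h4, h5⟩ := ih d
    refine ⟨(e, d) :: q, c', ⟨?_, ?_⟩, ?_, ?_⟩
    · rw [origin_edg]
      exact vtx_eq_iff.2 ⟨rfl, Δ.δ_mem_symm h1⟩
    · rw [terminus_edg]
      exact h3
    · rw [List.map_cons, wordElt, Prod.map_apply, h4, id, h2, inv_mul_cancel_left,
        vertexElt'_of_mem a.2]
    · simp [h5, h2, mul_assoc]

/-- If the residue graph has no circuits, then closed paths have trivial words. -/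
theorem wordElt_eq_one (hG : ∀ p, ¬ (𝒢.residueGraph Δ Set.univ).IsCircuit p) (c₀ : C) {v : V}
    {c : C} {q : List (E × C)}
    (hq : (𝒢.residueGraph Δ Set.univ).IsPath (𝒢.vtx Δ v c) (q.map fun x => 𝒢.edg Δ x.1 x.2)
      (𝒢.vtx Δ v c)) :
    𝒢.wordElt cs v (Δ.retract c₀ c) (Δ.retract c₀ c)
      (q.map (Prod.map id (Δ.retract c₀))) = 1 := by
  induction hn : q.length using Nat.strong_induction_on generalizing q with
  | _ n ih =>
    by_cases hr : (𝒢.residueGraph Δ Set.univ).Reduced (q.map fun x => 𝒢.edg Δ x.1 x.2)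
    · have := SerreGraph.eq_nil_of_reduced hG hq hr
      rw [List.map_eq_nil_iff] at this
      subst this
      rw [List.map_nil, wordElt, inv_mul_cancel, vertexElt'_of_mem (one_mem _)]
      exact 𝒢.vertexElt_one cs v
    · obtain ⟨a', ε, b', hab⟩ := SerreGraph.exists_backtrack_of_not_reduced hr
      have hq' := hq
      rw [hab] at hq'
      have hpath := hq'.remove_backtrack
      obtain ⟨a, r, rfl, rfl, hr'⟩ := List.map_eq_append_iff.1 hab
      obtain ⟨⟨e, c₁⟩, r, rfl, rfl, hr''⟩ := List.map_eq_cons_iff.1 hr'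
      obtain ⟨⟨f, c₂⟩, b, rfl, hf, rfl⟩ := List.map_eq_cons_iff.1 hr''
      rw [inv_edg, edg_eq_iff] at hf
      obtain ⟨rfl, hf⟩ := hf
      rw [𝒢.eset_inv] at hf
      rw [← List.map_append] at hpath
      have h1 := ih _ (by simp [← hn]) hpath rfl
      -- Words are read off in W: the retraction turns the backtrack in Δ into one in the thin
      -- graph, where deleting it does not change the word.
      have hT := isPath_map_retractEdge c₀ hq
      rw [retractVertex_vtx, List.map_map] at hT
      have hcomp : (𝒢.retractEdge Δ c₀ ∘ fun x : E × C => 𝒢.edg Δ x.1 x.2) =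
          (fun x => 𝒢.edg (Building.thin cs) x.1 x.2) ∘ Prod.map id (Δ.retract c₀) := by
        funext x
        exact retractEdge_edg c₀ x.1 x.2
      rw [hcomp, ← List.map_map, List.map_append, List.map_cons, List.map_cons] at hT
      rw [← h1, List.map_append, List.map_append, List.map_cons, List.map_cons]
      exact wordElt_remove_backtrack hT (Δ.retract_inv_mul_mem c₀ (Δ.δ_mem_symm hf))

theorem isVisualDecomposition_of_isTree (x₀ : V) (hS : (⋃ v, 𝒢.vset v) = Set.univ)
    (hG : (𝒢.residueGraph Δ Set.univ).IsTree) : 𝒢.IsVisualDecomposition cs x₀ := by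
  refine ⟨(injective_iff_map_eq_one _).2 ?_, tau_surjective hS x₀⟩
  rintro ⟨x, hx⟩ hτ
  obtain ⟨c₀⟩ := Δ.nonempty
  -- Starting at the centre of the retraction matters: c₀ is the only chamber retracting to 1, so
  -- τ(x) = 1 closes the lifted path.
  obtain ⟨q, c', h1, h2, h3⟩ := IsPathWord.exists_isPath hx Δ c₀ c₀
  have hτ' : 𝒢.pathTau cs x = 1 := hτ
  rw [hτ', mul_one, Δ.retract_eq_one_iff.2 rfl, Δ.retract_eq_one_iff] at h3
  subst h3
  exact Subtype.ext (h2.symm.trans (wordElt_eq_one hG.2 c' h1))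

end SpecialGraph

theorem theoremF {B : Type*} [Finite B] {W : Type*} [Group W] {M : CoxeterMatrix B}
    (cs : CoxeterSystem M W) {C : Type*} (Δ : Building cs C)
    {V E : Type*} {Λ : SerreGraph V E} (𝒢 : SpecialGraph B Λ) (x₀ : V) :
    𝒢.IsVisualDecomposition cs x₀ ↔
      (⋃ v, 𝒢.vset v) = Set.univ ∧ (𝒢.residueGraph Δ Set.univ).IsTree :=
  ⟨SpecialGraph.isTree_of_isVisualDecomposition,
    fun h => SpecialGraph.isVisualDecomposition_of_isTree x₀ h.1 h.2⟩
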